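/- **Setting.** Let $\omega=(\sqrt5+1)/2$, $\beta=1/\omega=(\sqrt5-1)/2$, $\mathbb K=\mathbb Q(\sqrt5)$ and $\mathbf u_m=(\cos\frac{2\pi m}5,\sin\frac{2\pi m}5)$ for $m=0,\dots,4$. Write $[(m_1,\dots,m_n),(\epsilon_1,\dots,\epsilon_n),(b_1,\dots,b_n)]$ for the set of $\mathbf x\in\mathbb R^2$ with $\mathbf u_{m_i}\cdot\mathbf x<b_i$ if $\epsilon_i=1$ and $\mathbf u_{m_i}\cdot\mathbf x\geq b_i$ if $\epsilon_i=-1$, for all $i$; a *tile* is such a set which is bounded and has non-empty interior. Let $\mathtt R_m$ be the rotation by $2\pi m/5$ about the origin, and $\mathtt T_{(p,q)}$ the translation by the vector $\mathbf d$ with $\mathbf u_0\cdot\mathbf d=p$, $\mathbf u_1\cdot\mathbf d=q$. A *dressed domain* is a set $X$ with a partition into finitely many tiles (atoms) $X_k$ and, for every $k$, a composition $\rho_k$ of some $\mathtt R_m$ and a translation, with $\rho_k(X_k)\subset X$; these define a piecewise isometry of $X$. A *dressed subdomain* is a dressed domain $\mathcal Y$ on a subset $Y\subset X$ whose piecewise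 isometry is the first-return map to $Y$. Two dressed domains are *similar* ($\sim$) if one is the image (of the domain and the atoms, with conjugation of the isometries) of the other under an element of the group generated by the $\mathtt R_m$, the reflections about the lines generated by the $\mathbf u_m$, the translations $\mathtt T_{(p,q)}$ with $p,q\in\mathbb K$, and the scalings by positive reals. A dressed subdomain is scaled by the factor $c$ if the diameter of its domain is $c$ times that of $X$. The *base triangle* $\mathcal B=\mathcal B(\tau)$, $0<\tau<1$, has the domain $B=[(1,0,2),(-1,1,1),(\tau-\omega^2,0,0)]$, the atoms $$\begin{aligned}B_1&=[(0,2,3),(1,1,1),(0,0,\omega-\omega\tau)],\\ B_2&=[(1,4,0,3,2),(-1,1,1,-1,1),(\tau-\omega^2,\omega^2-\omega\tau,0,\omega-\omega\tau,0)],\\ B_3&=[(1,0,4),(-1,1,-1),(\tau-\omega^2,0,\omega^2-\omega\tau)]\end{aligned}$$ and the isometries $\rho_1=\mathtt T_{(\omega\tau-\omega,\,\omega^2\tau-\omega^2)}\mathtt R_2$, $\rho_2=\mathtt T_{(0,\,\omega^2\tau-\omega^3)}\mathtt R_3$, $\rho_3=\mathtt T_{(\omega\tau-2\omega,\,\omega^2\tau-2\omega^2)}\mathtt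 R_2$. The dressed domain $\tilde{\mathcal B}(\tau)$ is obtained by changing the signs of all $\epsilon_i$, all $b_i$ and all translation vectors. These definitions are extended to the two-atom cases $\tau=0$ (without the atom $B_3$) and $\tau=1$ (without the atom $B_1$); there the domain is the triangle without its apex (the origin), and the two atoms are intersected with it. Let $$r(\tau)=\begin{cases}\omega^2\tau,&0<\tau<\beta^2,\\ \omega^3(\beta-\tau),&\beta^2<\tau<\beta,\\ \omega^2(1-\tau),&\beta<\tau<1,\\ 0,&\tau\in\{0,\beta^2,\beta,1\}.\end{cases}$$ **Lemma.** 1. (i) For $0<\tau<\beta^2$, $\mathcal B(\tau)$ has a dressed subdomain $\mathcal B_1\sim\mathcal B(r(\tau))$, scaled by the factor $(1-\tau)/(\omega^2-\tau)$, on the triangle $[(1,0,2),(-1,1,1),(\tau-1,0,0)]$. (ii) For $\beta^2<\tau<\beta$, it has a dressed subdomain $\mathcal B_2\sim\tilde{\mathcal B}(r(\tau))$, scaled by the factor $\tau/(\omega^2-\tau)$, on $B_3$. (iii) For $\beta<\tau<1$, it has a dressed subdomain $\mathcal B_3\sim\tilde{\mathcal B}(r(\tau))$, scaled by the factor $\tau/(\omega^2-\tau)$,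 on $B_3$. In each case $r(\tau)\in(0,1)$, every atom of the subdomain moves as a whole until it returns (within a single atom of $\mathcal B$ at each step), with a return time common to all its points, and the return orbits of these atoms, together with the orbits of finitely many periodic tiles, are pairwise disjoint and cover the triangle. The same holds with the roles of $\mathcal B$ and $\tilde{\mathcal B}$ exchanged (and the signs of the $\epsilon_i$ and $b_i$ of the triangle in (i) changed). 2. For $\tau\in\{0,\beta^2,\beta,1\}$, each of $\mathcal B(\tau)$ and $\tilde{\mathcal B}(\tau)$ has a dressed subdomain of smaller diameter, similar to $\mathcal B(0)$ or to $\tilde{\mathcal B}(0)$, with the same tiling property, except that some of the finitely many periodic tiles may be single points. 3. For $\tau\in[0,1]$, the base triangle is self-similar, that is, $\tau$ is eventually periodic under $r$, if and only if $\tau\in\mathbb K$. -/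

import Mathlib

namespace PWI

noncomputable section

/-! ### Numbers -/

/-- The golden ratio `ω = (√5 + 1) / 2`. -/
def ω : ℝ := (√5 + 1) / 2

/-- `β = 1 / ω = (√5 - 1) / 2`. -/
def β : ℝ := (√5 - 1) / 2

/-- The field `ℚ(√5)`, as a set of real numbers. -/
def QSqrtFive : Set ℝ := {x | ∃ a b : ℚ, x = a + b * √5}

/-! ### Planar objects

The Euclidean plane is `ℂ`, with `(x, y)` written as `x + i y`. -/

/-- The unit vector `u_m = (cos (2πm/5), sin (2πm/5))`. -/
def u (m : Fin 5) : ℂ :=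
  ⟨Real.cos (2 * Real.pi * ((m : ℕ) : ℝ) / 5), Real.sin (2 * Real.pi * ((m : ℕ) : ℝ) / 5)⟩

/-- The Euclidean scalar product of the plane. -/
def dot (v z : ℂ) : ℝ := v.re * z.re + v.im * z.im

/-- The vector with pentagonal coordinates `(p, q)`, that is, the vector `d` with
`u_0 · d = p` and `u_1 · d = q` (see `dot_u_zero_pent` and `dot_u_one_pent`). -/
def pent (p q : ℝ) : ℂ :=
  ⟨p, (q - p * Real.cos (2 * Real.pi / 5)) / Real.sin (2 * Real.pi / 5)⟩

theorem dot_u_zero_pent (p q : ℝ) : dot (u 0) (pent p q) = p := by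
  simp [dot, u, pent]

theorem dot_u_one_pent (p q : ℝ) : dot (u 1) (pent p q) = q := by
  have h : Real.sin (2 * Real.pi / 5) ≠ 0 := by
    apply ne_of_gt
    apply Real.sin_pos_of_pos_of_lt_pi
    · positivity
    · linarith [Real.pi_pos]
  simp only [dot, u, pent, Fin.val_one, Nat.cast_one, mul_one]
  field_simp
  ring

/-- One edge condition of a tile: direction `m`, index `ε = ±1`, and coordinate `b`. -/
structure Side where
  m : Fin 5
  ε : ℤˣ
  b : ℝ

/-- The half-plane of an edge: `u_m · x < b` if `ε = 1` (excluded edge) and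
`u_m · x ≥ b` if `ε = -1` (included edge). -/
def Side.halfPlane (s : Side) : Set ℂ :=
  {z | if s.ε = 1 then dot (u s.m) z < s.b else s.b ≤ dot (u s.m) z}

/-- Change of sign of the coordinate and of the index of an edge. -/
def Side.neg (s : Side) : Side := ⟨s.m, -s.ε, -s.b⟩

/-- The set defined by a list of edge conditions. -/
def tile (L : List Side) : Set ℂ := {z | ∀ s ∈ L, z ∈ s.halfPlane}

/-- A tile: a (bounded, non-degenerate) convex polygon defined by finitely many edge
conditions. -/
def IsTile (S : Set ℂ) : Prop :=
  ∃ L : List Side, S = tile L ∧ Bornology.IsBounded S ∧ (interior S).Nonempty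

/-! ### Groups of transformations -/

/-- The similarity group: it is generated by the rotations `R_m`, the reflections `U_m` about the
line generated by `u_m`, the translations with coordinates in `ℚ(√5)`, and the scalings
by positive real factors. (Conjugation by scalings produces all the other translations.) -/
def similarityGroup : Subgroup (Equiv.Perm ℂ) :=
  Subgroup.closure {G |
    (∃ m : Fin 5, ∀ z, G z = u m * z) ∨
    (∃ m : Fin 5, ∀ z, G z = u m ^ 2 * (starRingEnd ℂ) z) ∨
    (∃ p ∈ QSqrtFive, ∃ q ∈ QSqrtFive, ∀ z, G z = z + pent p q) ∨
    (∃ η : ℝ, 0 < η ∧ ∀ z, G z = (η : ℂ) * z)}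

/-- The isometry `T_d R_m`: rotation by `2πm/5` followed by translation by `d`. -/
def rotTrans (m : Fin 5) (d : ℂ) : ℂ → ℂ := fun z => u m * z + d

/-! ### Dressed domains -/

/-- The data of a dressed domain: a domain and a set of atoms, each a pair formed by a tile and the
isometry acting on it. -/
structure DressedDomain where
  dom : Set ℂ
  atoms : Set (Set ℂ × (ℂ → ℂ))

namespace DressedDomain

/-- The conditions on the data of a dressed domain: finitely many atoms, which are pairwise
disjoint tiles with union the domain; every isometry is a composition of a rotation by a multiple
of `2π/5` and a translation, and maps its tile into the domain. -/
structure IsDressed (X : DressedDomain) : Prop where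
  finite : X.atoms.Finite
  isTile : ∀ a ∈ X.atoms, IsTile a.1
  isometry : ∀ a ∈ X.atoms, ∃ m d, a.2 = rotTrans m d
  disjoint : ∀ a ∈ X.atoms, ∀ b ∈ X.atoms, a ≠ b → Disjoint a.1 b.1
  cover : ⋃ a ∈ X.atoms, a.1 = X.dom
  mapsTo : ∀ a ∈ X.atoms, Set.MapsTo a.2 a.1 X.dom

open Classical in
/-- The piecewise isometry of a dressed domain (the identity outside the atoms). -/
def map (X : DressedDomain) (z : ℂ) : ℂ :=
  if h : ∃ a ∈ X.atoms, z ∈ a.1 then h.choose.2 z else z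

/-- The transform `G(X)` of a dressed domain. -/
def transform (G : Equiv.Perm ℂ) (X : DressedDomain) : DressedDomain where
  dom := G '' X.dom
  atoms := (fun a => (G '' a.1, G ∘ a.2 ∘ G.symm)) '' X.atoms

/-- Similarity of dressed domains. -/
def Similar (X Y : DressedDomain) : Prop := ∃ G ∈ similarityGroup, X = Y.transform G

/-- `n` is the first return time of `z` to the set `D` under the map of `X`. -/
def IsReturnTime (X : DressedDomain) (D : Set ℂ) (z : ℂ) (n : ℕ) : Prop :=
  0 < n ∧ X.map^[n] z ∈ D ∧ ∀ k, 0 < k → k < n → X.map^[k] z ∉ D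

/-- `Y` is a dressed sub-domain of `X`: the isometries of `Y` are the first-return map to the
domain of `Y` which is induced by the map of `X`. -/
structure IsSubdomain (Y X : DressedDomain) : Prop where
  dressed : Y.IsDressed
  dressed' : X.IsDressed
  subset : Y.dom ⊆ X.dom
  firstReturn : ∀ a ∈ Y.atoms, ∀ z ∈ a.1,
    ∃ n, X.IsReturnTime Y.dom z n ∧ X.map^[n] z = a.2 z

/-- The first `n` steps of the orbit of the set `S` are performed as a whole: each of
`S, …, map^[n-1] S` lies in a single atom of `X`. -/
def MovesWhole (X : DressedDomain) (S : Set ℂ) (n : ℕ) : Prop :=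
  ∀ k < n, ∃ b ∈ X.atoms, X.map^[k] '' S ⊆ b.1

/-- The set `P` is periodic with period `p`: after `p` steps, made as a whole, it comes back to
itself. -/
def IsPeriodicSet (X : DressedDomain) (P : Set ℂ) (p : ℕ) : Prop :=
  0 < p ∧ X.MovesWhole P p ∧ X.map^[p] '' P = P

/-- Given a set of pairs `(S, n)`, the orbit pieces `map^[k] S`, `k < n`, are pairwise disjoint and
their union is the domain of `X`. -/
def OrbitsTile (X : DressedDomain) (Q : Set (Set ℂ × ℕ)) : Prop :=
  (∀ q ∈ Q, ∀ q' ∈ Q, ∀ k < q.2, ∀ k' < q'.2, (q, k) ≠ (q', k') →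
    Disjoint (X.map^[k] '' q.1) (X.map^[k'] '' q'.1)) ∧
  ⋃ q ∈ Q, ⋃ k < q.2, X.map^[k] '' q.1 = X.dom

/-- The tiling property of a dressed sub-domain `Y` of `X`: every atom of `Y` has a return time and
moves as a whole until it returns, and the return orbits of the atoms of `Y`, together with the
orbits of finitely many periodic sets of the given kind, tile the domain of `X`. -/
def ReturnOrbitsTile (X Y : DressedDomain) (kind : Set ℂ → Prop) : Prop :=
  ∃ (T : Set ℂ × (ℂ → ℂ) → ℕ) (P : Set (Set ℂ × ℕ)),
    (∀ a ∈ Y.atoms, X.MovesWhole a.1 (T a) ∧ ∀ z ∈ a.1, X.IsReturnTime Y.dom z (T a)) ∧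
    P.Finite ∧
    (∀ q ∈ P, kind q.1 ∧ X.IsPeriodicSet q.1 q.2) ∧
    X.OrbitsTile ((fun a => (a.1, T a)) '' Y.atoms ∪ P)

end DressedDomain

/-! ### Base triangles -/

/-- The edges of the base triangle `B`. -/
def sidesB (τ : ℝ) : List Side := [⟨1, -1, τ - ω ^ 2⟩, ⟨0, 1, 0⟩, ⟨2, 1, 0⟩]

/-- The edges of the three atoms `B_1`, `B_2`, `B_3`, which have the indices `0`, `1`, `2`. -/
def sidesAtom (τ : ℝ) : Fin 3 → List Side :=
  ![[⟨0, 1, 0⟩, ⟨2, 1, 0⟩, ⟨3, 1, ω - ω * τ⟩],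
    [⟨1, -1, τ - ω ^ 2⟩, ⟨4, 1, ω ^ 2 - ω * τ⟩, ⟨0, 1, 0⟩, ⟨3, -1, ω - ω * τ⟩, ⟨2, 1, 0⟩],
    [⟨1, -1, τ - ω ^ 2⟩, ⟨0, 1, 0⟩, ⟨4, -1, ω ^ 2 - ω * τ⟩]]

/-- The edges of the sub-triangle of `B`, with the same apex and altitude `1 - τ`, on which one
induces for small `τ`. -/
def sidesSub (τ : ℝ) : List Side := [⟨1, -1, τ - 1⟩, ⟨0, 1, 0⟩, ⟨2, 1, 0⟩]

/-- The rotational parts of the isometries of the three atoms. -/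
def rotAtom : Fin 3 → Fin 5 := ![2, 3, 2]

/-- The translational parts of the isometries of the three atoms. -/
def transAtom (τ : ℝ) : Fin 3 → ℂ :=
  ![pent (ω * τ - ω) (-ω ^ 2 + ω ^ 2 * τ),
    pent 0 (ω ^ 2 * τ - ω ^ 3),
    pent (ω * τ - 2 * ω) (ω ^ 2 * τ - 2 * ω ^ 2)]

/-- For `t = false` the list itself, for `t = true` the list with the sign of all coordinates and
indices changed. -/
def signed (t : Bool) (L : List Side) : List Side := if t then L.map Side.neg else L

/-- The atom with index `i`: of `𝓑` for `t = false`, of `𝓑̃` for `t = true`. -/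
def atom (t : Bool) (τ : ℝ) (i : Fin 3) : Set ℂ := tile (signed t (sidesAtom τ i))

/-- The isometry of the atom with index `i`. -/
def iso (t : Bool) (τ : ℝ) (i : Fin 3) : ℂ → ℂ :=
  rotTrans (rotAtom i) (if t then -transAtom τ i else transAtom τ i)

/-- The base triangles with shape parameter `τ`: `𝓑` for `t = false`, and `𝓑̃` for `t = true`. -/
def base (t : Bool) (τ : ℝ) : DressedDomain where
  dom := tile (signed t (sidesB τ))
  atoms := Set.range fun i => (atom t τ i, iso t τ i)

/-- The limiting case in which the atom with index `i` has disappeared. The other two atoms tile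
the triangle without its apex, which is the origin. -/
def twoAtom (t : Bool) (τ : ℝ) (i : Fin 3) : DressedDomain where
  dom := tile (signed t (sidesB τ)) \ {0}
  atoms := {a | ∃ j, j ≠ i ∧
    a = (atom t τ j ∩ (tile (signed t (sidesB τ)) \ {0}), iso t τ j)}

/-- The base triangles for `0 ≤ τ ≤ 1`: at `τ = 0` the atom `B_3` disappears, and at `τ = 1` the
atom `B_1` does. -/
def baseExt (t : Bool) (τ : ℝ) : DressedDomain :=
  if τ = 0 then twoAtom t 0 2 else if τ = 1 then twoAtom t 1 0 else base t τ

/-- The renormalization function. -/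
def r (τ : ℝ) : ℝ :=
  if 0 < τ ∧ τ < β ^ 2 then ω ^ 2 * τ
  else if β ^ 2 < τ ∧ τ < β then ω ^ 3 * (β - τ)
  else if β < τ ∧ τ < 1 then ω ^ 2 * (1 - τ)
  else 0

/-- The base triangle with shape parameter `τ` is self-similar: `τ` is eventually periodic under
the renormalization function. -/
def SelfSimilar (τ : ℝ) : Prop := ∃ m n : ℕ, m < n ∧ r^[m] τ = r^[n] τ

/-- `X` has a dressed sub-domain on the set `D`, similar to `Z` and scaled by the factor `c` with
respect to `X`, whose return orbits, together with finitely many periodic tiles, tile `X`. -/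
def Renormalizes (X Z : DressedDomain) (D : Set ℂ) (c : ℝ) : Prop :=
  ∃ Y : DressedDomain, Y.dom = D ∧ Y.IsSubdomain X ∧ Y.Similar Z ∧
    Metric.diam Y.dom = c * Metric.diam X.dom ∧ X.ReturnOrbitsTile Y IsTile

/-- `X` has a smaller dressed sub-domain similar to `Z`, whose return orbits, together with
finitely many periodic tiles and periodic points (degenerate tiles), tile `X`. -/
def RenormalizesLimit (X Z : DressedDomain) : Prop :=
  ∃ Y : DressedDomain, Y.IsSubdomain X ∧ Y.Similar Z ∧
    Metric.diam Y.dom < Metric.diam X.dom ∧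
    X.ReturnOrbitsTile Y fun P => IsTile P ∨ ∃ z, P = {z}

end

end PWI

/-! The renormalization statements are finite computations made uniform in `τ`. On each of the three
ranges `τ` is an affine function of a parameter `s` in the open unit interval, with end values in
`ℤ[ω]`; here `s` is `r τ` on the increasing branch and `1 - r τ` on the decreasing ones. All edges
have normals at multiples of 36°, and the isometries rotate by multiples of 72° and translate by
vectors affine in `τ` over `ℤ[ω]`. So each edge of each tile, along any prescribed itinerary, has a
bound that is affine in `s` with end values in `ℤ[ω]`. A sign on the open interval then follows from
the signs at the two ends, which are decided by integer arithmetic (`GoldenInt.val_of_isPos`,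
`Segment.val_of_isPos`).

Geometry enters through one fact: half-planes have empty intersection if a positive relation between
two or three of their normals contradicts their bounds (`not_sat_of_isEmptyWith`). Disjointness,
inclusion and covering of polygons all reduce to it. A certificate consists of a similarity onto the
subdomain, the itineraries of its atoms and some periodic cells. `Certificate.sound` shows that the
tests imply the subdomain, the similarity and the tiling: composed isometries are compared with
conjugated ones, and disjointness of the orbit pieces makes each return a first return. The scaling
factors are ratios of altitudes, since all base triangles have homothetic closures up to a
half-turn. The limiting parameters use the same machinery with constant data.

The criterion for self-similarity is arithmetic. Every iterate of `r` is locally affine over `ℚ(√5)`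
with slope zero or of modulus above one, so a periodic value solves a nondegenerate linear equation
over the field, and the branches can be inverted over the field (`mem_of_selfSimilar`). Conversely,
the multipliers `±ω ^ 2`, `±ω ^ 3` are algebraic integers whose conjugates contract. Along an orbit
in `ℚ(√5)` the denominator can therefore be kept fixed and the conjugate of the numerator stays
bounded (`r_mem_boundedHeight`); only finitely many values remain, and the orbit repeats. -/

namespace PWI

/-! ### Golden integers -/

theorem sqrt_five_sq : √5 ^ 2 = (5 : ℝ) := Real.sq_sqrt (by norm_num)

theorem ω_sq : ω ^ 2 = ω + 1 := by
  unfold ω; nlinarith [sqrt_five_sq]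

theorem β_eq : β = ω - 1 := by unfold β ω; ring

theorem β_mul_ω : β * ω = 1 := by rw [β_eq]; nlinarith [ω_sq]

theorem one_lt_ω : 1 < ω := by
  have : (1 : ℝ) < √5 := by rw [Real.lt_sqrt] <;> norm_num
  unfold ω; linarith

theorem ω_lt_two : ω < 2 := by
  have : √5 < (3 : ℝ) := by rw [Real.sqrt_lt'] <;> norm_num
  unfold ω; linarith

/-- The number `a + b ω`. -/
@[ext]
structure GoldenInt where
  a : ℤ
  b : ℤ
deriving DecidableEq

namespace GoldenInt

/-- The value of a golden integer. -/
noncomputable def val (p : GoldenInt) : ℝ := p.a + p.b * ω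

instance : Zero GoldenInt := ⟨⟨0, 0⟩⟩
instance : One GoldenInt := ⟨⟨1, 0⟩⟩
instance : Add GoldenInt := ⟨fun p q => ⟨Int.add p.a q.a, Int.add p.b q.b⟩⟩
instance : Neg GoldenInt := ⟨fun p => ⟨Int.neg p.a, Int.neg p.b⟩⟩
instance : Mul GoldenInt :=
  ⟨fun p q => ⟨p.a * q.a + p.b * q.b, p.a * q.b + p.b * q.a + p.b * q.b⟩⟩

@[simp] theorem val_zero : (0 : GoldenInt).val = 0 := by
  change ((0 : ℤ) : ℝ) + ((0 : ℤ) : ℝ) * ω = 0; simp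

@[simp] theorem val_one : (1 : GoldenInt).val = 1 := by
  change ((1 : ℤ) : ℝ) + ((0 : ℤ) : ℝ) * ω = 1; simp

@[simp] theorem val_add (p q : GoldenInt) : (p + q).val = p.val + q.val := by
  change ((p.a + q.a : ℤ) : ℝ) + ((p.b + q.b : ℤ) : ℝ) * ω = _
  simp only [val]; push_cast; ring

@[simp] theorem val_neg (p : GoldenInt) : (-p).val = -p.val := by
  change ((-p.a : ℤ) : ℝ) + ((-p.b : ℤ) : ℝ) * ω = _
  simp only [val]; push_cast; ring

@[simp] theorem val_mul (p q : GoldenInt) : (p * q).val = p.val * q.val := by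
  change ((p.a * q.a + p.b * q.b : ℤ) : ℝ) + ((p.a * q.b + p.b * q.a + p.b * q.b : ℤ) : ℝ) * ω = _
  simp only [val]; push_cast; linear_combination (-(p.b * q.b : ℝ)) * ω_sq

/-- The integer `n` as a golden integer. -/
def ofNat (n : ℕ) : GoldenInt := ⟨n, 0⟩

@[simp] theorem val_ofNat (n : ℕ) : (ofNat n).val = n := by simp [ofNat, val]

/-- Whether the value vanishes. -/
def isZero (p : GoldenInt) : Bool :=
  match p.a, p.b with
  | .ofNat m, .ofNat n => Nat.beq m 0 && Nat.beq n 0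
  | _, _ => false

/-- Whether the value is positive. -/
def isPos (p : GoldenInt) : Bool :=
  match p.a, p.b with
  | .ofNat m, .ofNat n => Nat.blt 0 m || Nat.blt 0 n
  | .negSucc m, .ofNat n => Nat.blt ((m + 1) * (m + 1)) ((m + 1) * n + n * n)
  | .ofNat m, .negSucc n => Nat.blt (m * (n + 1) + (n + 1) * (n + 1)) (m * m)
  | .negSucc _, .negSucc _ => false

/-- Whether the value is nonnegative. -/
def isNonneg (p : GoldenInt) : Bool := p.isZero || p.isPos

theorem val_of_isZero {p : GoldenInt} (h : p.isZero = true) : p.val = 0 := by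
  obtain ⟨m | m, n | n⟩ := p <;> simp_all [isZero, val]

/-- When the coefficients have opposite signs, the test is the sign of `m² - m k - k² = (m - k ω) (m
+ k β)`, whose second factor is positive for positive `m` and `k`. -/
theorem val_of_isPos {p : GoldenInt} (h : p.isPos = true) : 0 < p.val := by
  have h1 := one_lt_ω
  have h2 := ω_sq
  obtain ⟨m | m, n | n⟩ := p
  · simp only [isPos, Bool.or_eq_true, Nat.blt_eq] at h
    simp only [val, Int.ofNat_eq_natCast, Int.cast_natCast]
    rcases h with h | h
    · have : (0 : ℝ) < m := by exact_mod_cast h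
      positivity
    · have : (0 : ℝ) < n := by exact_mod_cast h
      positivity
  · simp only [isPos, Nat.blt_eq] at h
    have h : (m : ℝ) * (n + 1) + (n + 1) * (n + 1) < m * m := by exact_mod_cast h
    simp only [val, Int.ofNat_eq_natCast, Int.cast_natCast, Int.cast_negSucc, Nat.cast_add,
      Nat.cast_one]
    have h3 : (0 : ℝ) ≤ n := n.cast_nonneg
    have h4 : (0 : ℝ) ≤ m := m.cast_nonneg
    by_contra hn
    have h5 : (m : ℝ) ≤ (n + 1) * ω := by linarith
    nlinarith [mul_le_mul h5 h5 h4 (by positivity),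
      mul_nonneg (sub_nonneg.2 h5) (by positivity : (0 : ℝ) ≤ n + 1)]
  · simp only [isPos, Nat.blt_eq] at h
    have h : ((m : ℝ) + 1) * (m + 1) < (m + 1) * n + n * n := by exact_mod_cast h
    simp only [val, Int.ofNat_eq_natCast, Int.cast_natCast, Int.cast_negSucc, Nat.cast_add,
      Nat.cast_one]
    have h3 : (0 : ℝ) ≤ n := n.cast_nonneg
    have h4 : (0 : ℝ) ≤ m := m.cast_nonneg
    by_contra hn
    have h5 : (n : ℝ) * ω ≤ m + 1 := by linarith
    nlinarith [mul_le_mul h5 h5 (by positivity) (by positivity),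
      mul_nonneg (sub_nonneg.2 h5) h3]
  · simp [isPos] at h

theorem val_of_isNonneg {p : GoldenInt} (h : p.isNonneg = true) : 0 ≤ p.val := by
  simp only [isNonneg, Bool.or_eq_true] at h
  rcases h with h | h
  · exact (val_of_isZero h).ge
  · exact (val_of_isPos h).le

end GoldenInt

/-- The inverse of a unit. -/
def GoldenInt.inv (c : GoldenInt) : GoldenInt :=
  -- The norm, which is `±1` for a unit, so `n` times the conjugate is the inverse.
  let n := c.a * c.a + c.a * c.b - c.b * c.b
  ⟨n * (c.a + c.b), -(n * c.b)⟩

/-- An affine function on the unit interval, given by its values at `0` and at `1`. -/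
structure Segment where
  lo : GoldenInt
  hi : GoldenInt
deriving DecidableEq

namespace Segment

/-- The value at `s`. -/
noncomputable def val (s : ℝ) (p : Segment) : ℝ := (1 - s) * p.lo.val + s * p.hi.val

instance : Zero Segment := ⟨⟨0, 0⟩⟩
instance : Add Segment := ⟨fun p q => ⟨p.lo + q.lo, p.hi + q.hi⟩⟩
instance : Neg Segment := ⟨fun p => ⟨-p.lo, -p.hi⟩⟩
instance : SMul GoldenInt Segment := ⟨fun c p => ⟨c * p.lo, c * p.hi⟩⟩

/-- The constant function. -/
def const (c : GoldenInt) : Segment := ⟨c, c⟩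

/-- The product with `ω`. -/
def mulω (p : Segment) : Segment := ⟨⟨p.lo.b, p.lo.a + p.lo.b⟩, ⟨p.hi.b, p.hi.a + p.hi.b⟩⟩

/-- The product with `β`. -/
def mulβ (p : Segment) : Segment := ⟨⟨p.lo.b - p.lo.a, p.lo.a⟩, ⟨p.hi.b - p.hi.a, p.hi.a⟩⟩

variable (s : ℝ) (p q : Segment) (c : GoldenInt)

@[simp] theorem val_zero : (0 : Segment).val s = 0 := by
  change (1 - s) * (0 : GoldenInt).val + s * (0 : GoldenInt).val = 0; simp

@[simp] theorem val_add : (p + q).val s = p.val s + q.val s := by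
  change (1 - s) * (p.lo + q.lo).val + s * (p.hi + q.hi).val = _
  simp [val]; ring

@[simp] theorem val_neg : (-p).val s = -p.val s := by
  change (1 - s) * (-p.lo).val + s * (-p.hi).val = _
  simp [val]; ring

@[simp] theorem val_smul : (c • p).val s = c.val * p.val s := by
  change (1 - s) * (c * p.lo).val + s * (c * p.hi).val = _
  simp [val]; ring

@[simp] theorem val_const : (const c).val s = c.val := by simp [val, const]; ring

@[simp] theorem val_mulω : p.mulω.val s = ω * p.val s := by
  simp only [val, mulω, GoldenInt.val]; push_cast
  linear_combination (-(1 - s) * p.lo.b - s * p.hi.b) * ω_sq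

@[simp] theorem val_mulβ : p.mulβ.val s = β * p.val s := by
  simp only [val, mulβ, GoldenInt.val, β_eq]; push_cast
  linear_combination (-(1 - s) * p.lo.b - s * p.hi.b) * ω_sq

/-- Positivity on the open unit interval. -/
def isPos : Bool := p.lo.isNonneg && p.hi.isNonneg && (p.lo.isPos || p.hi.isPos)

/-- Nonnegativity on the open unit interval. -/
def isNonneg : Bool := p.lo.isNonneg && p.hi.isNonneg

variable {s p}

theorem val_of_isNonneg (hs : s ∈ Set.Ioo (0 : ℝ) 1) (h : p.isNonneg = true) : 0 ≤ p.val s := by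
  simp only [isNonneg, Bool.and_eq_true] at h
  have h1 := GoldenInt.val_of_isNonneg h.1
  have h2 := GoldenInt.val_of_isNonneg h.2
  have h3 := hs.1
  have h4 : 0 < 1 - s := sub_pos.2 hs.2
  unfold val
  positivity

/-- One end value may vanish because `s` avoids both ends. This is what allows strict inequalities
that degenerate at the ends of a parameter range. -/
theorem val_of_isPos (hs : s ∈ Set.Ioo (0 : ℝ) 1) (h : p.isPos = true) : 0 < p.val s := by
  simp only [isPos, Bool.and_eq_true, Bool.or_eq_true] at h
  have h1 := GoldenInt.val_of_isNonneg h.1.1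
  have h2 := GoldenInt.val_of_isNonneg h.1.2
  have h3 := hs.1
  have h4 : 0 < 1 - s := sub_pos.2 hs.2
  unfold val
  rcases h.2 with h | h
  · have := GoldenInt.val_of_isPos h
    positivity
  · have := GoldenInt.val_of_isPos h
    positivity

end Segment

/-! ### The directions of the edges -/

theorem u_eq_pow (m : Fin 5) : u m = Complex.exp (2 * Real.pi * Complex.I / 5) ^ (m : ℕ) := by
  rw [← Complex.exp_nat_mul]
  have : ((m : ℕ) : ℂ) * (2 * Real.pi * Complex.I / 5) =
      ((2 * Real.pi * ((m : ℕ) : ℝ) / 5 : ℝ) : ℂ) * Complex.I := by push_cast; ring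
  rw [this, Complex.exp_mul_I, ← Complex.ofReal_cos, ← Complex.ofReal_sin]
  apply Complex.ext <;>
    simp [u, -Complex.ofReal_cos, -Complex.ofReal_sin, Complex.ofReal_re, Complex.ofReal_im]

theorem u_mul (m k : Fin 5) : u m * u k = u (m + k) := by
  have h5 : Complex.exp (2 * Real.pi * Complex.I / 5) ^ 5 = 1 := by
    rw [← Complex.exp_nat_mul]
    convert Complex.exp_two_pi_mul_I using 2
    push_cast; ring
  rw [u_eq_pow, u_eq_pow, u_eq_pow, ← pow_add, Fin.val_add, pow_eq_pow_mod _ h5]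

@[simp] theorem u_zero : u 0 = 1 := by rw [u_eq_pow]; simp

theorem norm_u (m : Fin 5) : ‖u m‖ = 1 := by
  rw [u_eq_pow, norm_pow, Complex.norm_exp]; simp

theorem u_ne_zero (m : Fin 5) : u m ≠ 0 := by
  rw [← norm_ne_zero_iff, norm_u]; exact one_ne_zero

theorem conj_u (m : Fin 5) : (starRingEnd ℂ) (u m) = u (-m) := by
  have h1 : u m * u (-m) = 1 := by rw [u_mul, add_neg_cancel, u_zero]
  have h2 : u m * (starRingEnd ℂ) (u m) = 1 := by rw [Complex.mul_conj']; simp [norm_u]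
  exact mul_left_cancel₀ (u_ne_zero m) (h2.trans h1.symm)

theorem dot_eq_re (v z : ℂ) : dot v z = ((starRingEnd ℂ) v * z).re := by simp [dot]

theorem dot_add (v z w : ℂ) : dot v (z + w) = dot v z + dot v w := by simp [dot]; ring

theorem dot_real_mul (v : ℂ) (a : ℝ) (z : ℂ) : dot v (a * z) = a * dot v z := by
  simp [dot]; ring

theorem dot_u_mul (j k : Fin 5) (z : ℂ) : dot (u j) (u k * z) = dot (u (j - k)) z := by
  rw [dot_eq_re, dot_eq_re, conj_u, conj_u, ← mul_assoc, u_mul, neg_sub, sub_eq_neg_add]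

theorem dot_u_conj (j : Fin 5) (z : ℂ) : dot (u j) ((starRingEnd ℂ) z) = dot (u (-j)) z := by
  rw [← conj_u]; simp [dot]

theorem cos_two_pi_div_five : Real.cos (2 * Real.pi / 5) = β / 2 := by
  rw [mul_div_assoc, Real.cos_two_mul, Real.cos_pi_div_five, β]
  nlinarith [sqrt_five_sq]

/-- Since `u 1 + u 4 = 2 cos 72° = β`, multiplication by `u 1` gives `u 2 + u 0 = β * u 1`. -/
theorem dot_u_two (z : ℂ) : dot (u 2) z = β * dot (u 1) z - dot (u 0) z := by
  have h : u 2 = β * u 1 - u 0 := by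
    have h1 : u 1 + u 4 = β := by
      have : u 4 = (starRingEnd ℂ) (u 1) := by rw [conj_u]; rfl
      rw [this, Complex.add_conj]
      congr 1
      simp only [u, Fin.val_one, Nat.cast_one, mul_one, cos_two_pi_div_five]; ring
    have h2 : u 1 * u 1 = u 2 := u_mul 1 1
    have h3 : u 1 * u 4 = u 0 := u_mul 1 4
    rw [← h1, ← h2, ← h3]; ring
  rw [h]; simp [dot]; ring

theorem dot_u_add_two (m : Fin 5) (z : ℂ) :
    dot (u (m + 2)) z = β * dot (u (m + 1)) z - dot (u m) z := by
  have h := dot_u_two (u (-m) * z)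
  rw [dot_u_mul, dot_u_mul, dot_u_mul] at h
  simpa [add_comm] using h

/-- The coefficients of `dot (u 0)` and `dot (u 1)` in `dot (u m)`. -/
def coeff : Fin 5 → GoldenInt × GoldenInt
  | 0 => (⟨1, 0⟩, ⟨0, 0⟩)
  | 1 => (⟨0, 0⟩, ⟨1, 0⟩)
  | 2 => (⟨-1, 0⟩, ⟨-1, 1⟩)
  | 3 => (⟨1, -1⟩, ⟨1, -1⟩)
  | 4 => (⟨-1, 1⟩, ⟨-1, 0⟩)

theorem dot_u_eq (m : Fin 5) (z : ℂ) :
    dot (u m) z = (coeff m).1.val * dot (u 0) z + (coeff m).2.val * dot (u 1) z := by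
  have h2 := dot_u_add_two 0 z
  have h3 := dot_u_add_two 1 z
  have h4 := dot_u_add_two 2 z
  simp only [β_eq, zero_add, show (1 + 2 : Fin 5) = 3 from rfl, show (1 + 1 : Fin 5) = 2 from rfl,
    show (2 + 2 : Fin 5) = 4 from rfl, show (2 + 1 : Fin 5) = 3 from rfl] at h2 h3 h4
  have h := ω_sq
  fin_cases m <;> simp only [coeff, GoldenInt.val] <;> push_cast
  · simp
  · simp
  · rw [h2]; ring
  · rw [h3, h2]
    linear_combination dot (u 1) z * h
  · rw [h4, h3, h2]
    linear_combination ((ω - 2) * dot (u 1) z - dot (u 0) z) * h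

/-- The index of the direction of angle `36 j°`: `u (dirIndex j)` is `± 1` times the unit vector of
this angle. -/
def dirIndex (j : Fin 10) : Fin 5 := ⟨3 * j.val % 5, Nat.mod_lt _ (by norm_num)⟩

/-- The sign for `dirIndex`. -/
noncomputable def dirSign (j : Fin 10) : ℝ := if j.val % 2 = 0 then 1 else -1

/-- The scalar product with the unit vector of angle `36 j°`. -/
noncomputable def dirDot (j : Fin 10) (z : ℂ) : ℝ := dirSign j * dot (u (dirIndex j)) z

/-- The coefficients of `dot (u 0)` and `dot (u 1)` in `dirDot j`. -/
def normalCoeff : Fin 10 → GoldenInt × GoldenInt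
  | 0 => (⟨1, 0⟩, ⟨0, 0⟩)
  | 1 => (⟨-1, 1⟩, ⟨-1, 1⟩)
  | 2 => (⟨0, 0⟩, ⟨1, 0⟩)
  | 3 => (⟨1, -1⟩, ⟨1, 0⟩)
  | 4 => (⟨-1, 0⟩, ⟨-1, 1⟩)
  | 5 => (⟨-1, 0⟩, ⟨0, 0⟩)
  | 6 => (⟨1, -1⟩, ⟨1, -1⟩)
  | 7 => (⟨0, 0⟩, ⟨-1, 0⟩)
  | 8 => (⟨-1, 1⟩, ⟨-1, 0⟩)
  | 9 => (⟨1, 0⟩, ⟨1, -1⟩)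

/-- As 3 inverts 2 modulo 5, an even `j = 2 k` has the index `k`; an odd `j` has the index of the
opposite direction `j + 5`, and the sign `-1`. -/
theorem dirDot_eq (j : Fin 10) (z : ℂ) : dirDot j z =
    (normalCoeff j).1.val * dot (u 0) z + (normalCoeff j).2.val * dot (u 1) z := by
  have h : normalCoeff j = if j.val % 2 = 0 then coeff (dirIndex j) else
      (-(coeff (dirIndex j)).1, -(coeff (dirIndex j)).2) := by
    revert j; decide
  rw [dirDot, dot_u_eq, h, dirSign]
  split_ifs
  · simp
  · simp; ring

theorem dirDot_real_mul (j : Fin 10) (a : ℝ) (z : ℂ) : dirDot j (a * z) = a * dirDot j z := by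
  rw [dirDot, dirDot, dot_real_mul]; ring

theorem dirDot_zero (z : ℂ) : dirDot 0 z = dot (u 0) z := by
  simp [dirDot_eq, normalCoeff, GoldenInt.val]

theorem dirDot_two (z : ℂ) : dirDot 2 z = dot (u 1) z := by
  simp [dirDot_eq, normalCoeff, GoldenInt.val]

/-- Reduces linear relations between normals to identities in `ℤ[ω]`, which can be decided for all
directions at once. -/
theorem dirDot_relation {a b c : GoldenInt} {i j k : Fin 10}
    (h : (a * (normalCoeff i).1 + b * (normalCoeff j).1 + c * (normalCoeff k).1,
      a * (normalCoeff i).2 + b * (normalCoeff j).2 + c * (normalCoeff k).2) = (0, 0)) (z : ℂ) :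
    a.val * dirDot i z + b.val * dirDot j z + c.val * dirDot k z = 0 := by
  have h1 := congrArg GoldenInt.val (congrArg Prod.fst h)
  have h2 := congrArg GoldenInt.val (congrArg Prod.snd h)
  simp only [GoldenInt.val_add, GoldenInt.val_mul, GoldenInt.val_zero] at h1 h2
  rw [dirDot_eq i, dirDot_eq j, dirDot_eq k]
  linear_combination dot (u 0) z * h1 + dot (u 1) z * h2

theorem dirDot_add_five (j : Fin 10) (z : ℂ) : dirDot j z + dirDot (j + 5) z = 0 := by
  have := dirDot_relation (a := 1) (b := 1) (c := 0) (i := j) (j := j + 5) (k := 0)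
    (by revert j; decide) z
  simpa using this

theorem dirDot_add_three_add_seven (j : Fin 10) (z : ℂ) :
    β * dirDot j z + dirDot (j + 3) z + dirDot (j + 7) z = 0 := by
  have := dirDot_relation (a := ⟨-1, 1⟩) (b := 1) (c := 1) (i := j) (j := j + 3) (k := j + 7)
    (by revert j; decide) z
  have hb : (⟨-1, 1⟩ : GoldenInt).val = β := by simp [GoldenInt.val, β_eq]; ring
  simpa [hb] using this

theorem dirDot_add_four_add_six (j : Fin 10) (z : ℂ) :
    ω * dirDot j z + dirDot (j + 4) z + dirDot (j + 6) z = 0 := by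
  have := dirDot_relation (a := ⟨0, 1⟩) (b := 1) (c := 1) (i := j) (j := j + 4) (k := j + 6)
    (by revert j; decide) z
  have hb : (⟨0, 1⟩ : GoldenInt).val = ω := by simp [GoldenInt.val]
  simpa [hb] using this

theorem pent_eq (p q : ℝ) : pent p q = p * pent 1 0 + q * pent 0 1 := by
  apply Complex.ext
  · simp [pent]
  · simp [pent]; ring

theorem eq_of_dot_eq {z w : ℂ} (h0 : dot (u 0) z = dot (u 0) w) (h1 : dot (u 1) z = dot (u 1) w) :
    z = w := by
  have hs : Real.sin (2 * Real.pi / 5) ≠ 0 :=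
    (Real.sin_pos_of_pos_of_lt_pi (by positivity) (by linarith [Real.pi_pos])).ne'
  have hre : z.re = w.re := by simpa [dot, u] using h0
  apply Complex.ext hre
  simp only [dot, hre, add_right_inj, u, Fin.val_one, Nat.cast_one, mul_one] at h1
  exact mul_left_cancel₀ hs h1

theorem pent_dot (z : ℂ) : pent (dot (u 0) z) (dot (u 1) z) = z :=
  eq_of_dot_eq (dot_u_zero_pent _ _) (dot_u_one_pent _ _)

/-! ### Symbolic edges and polygons -/

/-- The sign of the coordinates: those of `𝓑̃` are reversed. -/
def sgn (t : Bool) : ℝ := if t then -1 else 1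

theorem sgn_mul_self (t : Bool) : sgn t * sgn t = 1 := by cases t <;> simp [sgn]

/-- An edge condition: the scalar product with the outer normal, of angle `36 angle°`, is bounded by
an affine function of a parameter. Even angles stand for the index `1`. -/
structure SymSide where
  angle : Fin 10
  bound : Segment
deriving DecidableEq

namespace SymSide

/-- The edge for the parameter `s`. -/
noncomputable def toSide (s : ℝ) (c : SymSide) : Side :=
  ⟨dirIndex c.angle, if c.angle.val % 2 = 0 then 1 else -1, dirSign c.angle * c.bound.val s⟩

/-- Whether the edge is excluded. -/
def isStrict (t : Bool) (c : SymSide) : Bool := Nat.beq (c.angle.val % 2) (bif t then 1 else 0)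

/-- The half-plane of a symbolic edge. -/
def Sat (t : Bool) (s : ℝ) (c : SymSide) (w : ℂ) : Prop :=
  if c.isStrict t then sgn t * dirDot c.angle w < c.bound.val s
  else sgn t * dirDot c.angle w ≤ c.bound.val s

theorem Sat.le {t : Bool} {s : ℝ} {c : SymSide} {w : ℂ} (h : c.Sat t s w) :
    sgn t * dirDot c.angle w ≤ c.bound.val s := by
  unfold Sat at h; split_ifs at h
  exacts [h.le, h]

theorem Sat.lt {t : Bool} {s : ℝ} {c : SymSide} {w : ℂ} (h : c.Sat t s w)
    (hc : c.isStrict t = true) : sgn t * dirDot c.angle w < c.bound.val s := by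
  rwa [Sat, if_pos hc] at h

/-- The complementary edge condition. -/
def compl (c : SymSide) : SymSide := ⟨c.angle + 5, -c.bound⟩

theorem isStrict_eq (t : Bool) (c : SymSide) :
    c.isStrict t = (decide (c.angle.val % 2 = 0) ^^ t) := by
  have : ∀ (j : Fin 10) (t : Bool), Nat.beq (j.val % 2) (bif t then 1 else 0) =
      (decide (j.val % 2 = 0) ^^ t) := by decide
  exact this _ _

theorem isStrict_compl (t : Bool) (c : SymSide) : c.compl.isStrict t = !c.isStrict t := by
  obtain ⟨j, b⟩ := c
  simp only [isStrict, compl]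
  revert j t; decide

/-- Turning the normal by 180° changes the parity of its angle, and with it strictness. The
convention on edges is thus closed under complements, and every inclusion becomes an emptiness
question. -/
theorem sat_compl {t : Bool} {s : ℝ} {c : SymSide} {w : ℂ} :
    c.compl.Sat t s w ↔ ¬ c.Sat t s w := by
  have h := dirDot_add_five c.angle w
  have h' : dirDot (c.angle + 5) w = -dirDot c.angle w := by linarith
  have e1 : sgn t * dirDot c.compl.angle w = -(sgn t * dirDot c.angle w) := by
    rw [compl, h']; ring
  have e2 : c.compl.bound.val s = -c.bound.val s := Segment.val_neg _ _
  simp only [Sat, isStrict_compl, e1, e2]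
  cases c.isStrict t <;> simp

end SymSide

/-- The polygon of a list of symbolic edges. -/
def polygon (t : Bool) (s : ℝ) (L : List SymSide) : Set ℂ :=
  tile (signed t (L.map (SymSide.toSide s)))

theorem mem_polygon {t : Bool} {s : ℝ} {L : List SymSide} {w : ℂ} :
    w ∈ polygon t s L ↔ ∀ c ∈ L, c.Sat t s w := by
  have hneg : ((-1 : ℤˣ) = 1) ↔ False := by decide
  cases t
  · simp only [polygon, tile, signed, Bool.false_eq_true, if_false, List.mem_map,
      Set.mem_ofPred_eq, forall_exists_index, and_imp, forall_apply_eq_imp_iff₂]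
    refine forall₂_congr fun c _ => ?_
    by_cases hc : c.angle.val % 2 = 0 <;>
      simp [Side.halfPlane, SymSide.toSide, SymSide.Sat, SymSide.isStrict_eq, dirDot, dirSign, hc,
        sgn, hneg]
    exact neg_le
  · simp only [polygon, tile, signed, if_true, List.mem_map, Set.mem_ofPred_eq,
      forall_exists_index, and_imp, forall_apply_eq_imp_iff₂]
    refine forall₂_congr fun c _ => ?_
    by_cases hc : c.angle.val % 2 = 0 <;>
      simp [Side.halfPlane, Side.neg, SymSide.toSide, SymSide.Sat, SymSide.isStrict_eq, dirDot,
        dirSign, hc, sgn, hneg, neg_le]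

/-! ### Emptiness, disjointness, inclusion and covering -/

/-- A sufficient condition for a half-plane to be disjoint from a polygon: one edge, or two edges,
of the polygon are in conflict with it. -/
def isEmptyWith (t : Bool) (c : SymSide) (L : List SymSide) : Bool :=
  let nonpos : Segment → Bool := fun p => (-p).isNonneg
  let empty : Segment → Bool := fun p => bif c.isStrict t then (-p).isNonneg else (-p).isPos
  L.any fun d =>
    let r := (d.angle - c.angle).val
    bif Nat.beq r 5 then nonpos (c.bound + d.bound)
    else bif Nat.beq r 2 then L.any fun e =>
      Nat.beq (e.angle - c.angle).val 6 && empty (c.bound + d.bound + e.bound.mulω)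
    else bif Nat.beq r 3 then L.any fun e =>
      let q := (e.angle - c.angle).val
      bif Nat.beq q 6 then nonpos (c.bound + d.bound.mulβ + e.bound)
      else Nat.beq q 7 && nonpos (c.bound.mulβ + d.bound + e.bound)
    else Nat.beq r 4 && L.any fun e =>
      let q := (e.angle - c.angle).val
      bif Nat.beq q 6 then empty (c.bound.mulω + d.bound + e.bound)
      else bif Nat.beq q 7 then nonpos (c.bound + d.bound + e.bound.mulβ)
      else Nat.beq q 8 && empty (c.bound + d.bound.mulω + e.bound)

/-- A Farkas argument: a vanishing positive combination of normals bounds zero by the same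
combination of the bounds. Besides opposite pairs, three directions at multiples of 36° are
positively dependent exactly when their gaps, in some cyclic order, are `2, 4, 4` or `3, 3, 4`; the
weights involve only `1`, `ω` and `β`. With gaps `2, 4, 4` the three edges are all strict or all
weak, so the weak case needs a negative sum of bounds. In the other cases strict and weak edges both
occur, and a nonpositive sum is enough. -/
theorem not_sat_of_isEmptyWith {t : Bool} {s : ℝ} (hs : s ∈ Set.Ioo (0 : ℝ) 1) {c : SymSide}
    {L : List SymSide} (h : isEmptyWith t c L = true) {w : ℂ} (hw : ∀ d ∈ L, d.Sat t s w) :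
    ¬ c.Sat t s w := by
  intro hc
  have hω : 0 < ω := by linarith [one_lt_ω]
  have hβ : 0 < β := by rw [β_eq]; linarith [one_lt_ω]
  have angle_eq : ∀ {d : SymSide} {k : Fin 10}, Nat.beq (d.angle - c.angle).val k = true →
      d.angle = c.angle + k := fun {d k} h =>
    sub_eq_iff_eq_add'.1 (Fin.ext (Nat.eq_of_beq_eq_true h))
  have strict_eq : ∀ {d : SymSide} {k : Fin 10}, Nat.beq (d.angle - c.angle).val k = true →
      d.isStrict t = (c.isStrict t ^^ decide (k.val % 2 = 1)) := fun {d k} h => by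
    rw [SymSide.isStrict, SymSide.isStrict, angle_eq h]
    have : ∀ (j k : Fin 10) (t : Bool), Nat.beq ((j + k).val % 2) (bif t then 1 else 0) =
        (Nat.beq (j.val % 2) (bif t then 1 else 0) ^^ decide (k.val % 2 = 1)) := by decide
    exact this _ _ _
  have nonpos : ∀ {p : Segment}, (-p).isNonneg = true → p.val s ≤ 0 := fun {p} h => by
    have := Segment.val_of_isNonneg hs h
    rw [Segment.val_neg] at this; linarith
  have neg : ∀ {p : Segment}, (-p).isPos = true → p.val s < 0 := fun {p} h => by
    have := Segment.val_of_isPos hs h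
    rw [Segment.val_neg] at this; linarith
  have empty : ∀ {p : Segment}, (bif c.isStrict t then (-p).isNonneg else (-p).isPos) = true →
      if c.isStrict t then p.val s ≤ 0 else p.val s < 0 := fun {p} h => by
    cases hc : c.isStrict t <;> simp only [hc, cond_true, cond_false] at h
    · simpa using neg h
    · simpa using nonpos h
  -- An odd gap means opposite parities, so one of the two edges is strict.
  have strict_or : ∀ {d : SymSide} {k : Fin 10}, Nat.beq (d.angle - c.angle).val k = true →
      decide (k.val % 2 = 1) = true → d.Sat t s w →
      sgn t * dirDot c.angle w < c.bound.val s ∨ sgn t * dirDot d.angle w < d.bound.val s := by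
    intro d k h hk hd
    have h1 := strict_eq h
    rw [hk] at h1
    cases h2 : c.isStrict t
    · exact Or.inr (hd.lt (by rw [h1, h2]; rfl))
    · exact Or.inl (hc.lt h2)
  have five : ∀ j : Fin 10, sgn t * dirDot j w + sgn t * dirDot (j + 5) w = 0 := fun j => by
    linear_combination sgn t * dirDot_add_five j w
  have seven : ∀ j : Fin 10, β * (sgn t * dirDot j w) + sgn t * dirDot (j + 3) w +
      sgn t * dirDot (j + 7) w = 0 := fun j => by
    linear_combination sgn t * dirDot_add_three_add_seven j w
  have six : ∀ j : Fin 10, ω * (sgn t * dirDot j w) + sgn t * dirDot (j + 4) w +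
      sgn t * dirDot (j + 6) w = 0 := fun j => by
    linear_combination sgn t * dirDot_add_four_add_six j w
  have add_add : ∀ {i j k l : Fin 10}, j + k = l → i + j + k = i + l := fun {i j k l} h => by
    rw [add_assoc, h]
  simp only [isEmptyWith, List.any_eq_true] at h
  obtain ⟨d, hd, h⟩ := h
  have hd := hw d hd
  have hdle := hd.le
  have hcle := hc.le
  have hcβ := mul_le_mul_of_nonneg_left hcle hβ.le
  have hdβ := mul_le_mul_of_nonneg_left hdle hβ.le
  have hdω := mul_le_mul_of_nonneg_left hdle hω.le
  cases h5 : Nat.beq (d.angle - c.angle).val 5 with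
  | true =>
    rw [h5, cond_true] at h
    have h1 := nonpos h
    have h2 := five c.angle
    rw [← angle_eq (k := 5) h5] at h2
    rw [Segment.val_add] at h1
    rcases strict_or (k := 5) h5 rfl hd with h3 | h3 <;> linarith
  | false =>
  rw [h5, cond_false] at h
  cases h2 : Nat.beq (d.angle - c.angle).val 2 with
  | true =>
    simp only [h2, cond_true, List.any_eq_true, Bool.and_eq_true] at h
    obtain ⟨e, he, h6, h⟩ := h
    have he := (hw e he).le
    have heω := mul_le_mul_of_nonneg_left he hω.le
    have h7 := six e.angle
    rw [angle_eq (k := 6) h6, add_add (show (6 + 4 : Fin 10) = 0 from rfl),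
      add_add (show (6 + 6 : Fin 10) = 2 from rfl), add_zero, ← angle_eq (k := 6) h6,
      ← angle_eq (k := 2) h2] at h7
    have h8 := empty h
    simp only [Segment.val_add, Segment.val_mulω] at h8
    split_ifs at h8 with h9
    · have := hc.lt h9
      linarith
    · linarith
  | false =>
  rw [h2, cond_false] at h
  cases h3 : Nat.beq (d.angle - c.angle).val 3 with
  | true =>
    simp only [h3, cond_true, List.any_eq_true] at h
    obtain ⟨e, he, h⟩ := h
    have he := (hw e he).le
    have hs' := strict_or (k := 3) h3 rfl hd
    cases h6 : Nat.beq (e.angle - c.angle).val 6 with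
    | true =>
      rw [h6, cond_true] at h
      have h7 := seven d.angle
      rw [angle_eq (k := 3) h3, add_add (show (3 + 3 : Fin 10) = 6 from rfl),
        add_add (show (3 + 7 : Fin 10) = 0 from rfl), add_zero, ← angle_eq (k := 6) h6,
        ← angle_eq (k := 3) h3] at h7
      have h8 := nonpos h
      simp only [Segment.val_add, Segment.val_mulβ] at h8
      rcases hs' with h9 | h9
      · linarith
      · have := mul_lt_mul_of_pos_left h9 hβ
        linarith
    | false =>
      simp only [h6, cond_false, Bool.and_eq_true] at h
      have h7 := seven c.angle
      rw [← angle_eq (k := 3) h3, ← angle_eq (k := 7) h.1] at h7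
      have h8 := nonpos h.2
      simp only [Segment.val_add, Segment.val_mulβ] at h8
      rcases hs' with h9 | h9
      · have := mul_lt_mul_of_pos_left h9 hβ
        linarith
      · linarith
  | false =>
  simp only [h3, cond_false, Bool.and_eq_true, List.any_eq_true] at h
  obtain ⟨h4, e, he, h⟩ := h
  have he' := hw e he
  have he := he'.le
  cases h6 : Nat.beq (e.angle - c.angle).val 6 with
  | true =>
    rw [h6, cond_true] at h
    have h7 := six c.angle
    rw [← angle_eq (k := 4) h4, ← angle_eq (k := 6) h6] at h7
    have h8 := empty h
    simp only [Segment.val_add, Segment.val_mulω] at h8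
    split_ifs at h8 with h9
    · have := mul_lt_mul_of_pos_left (hc.lt h9) hω
      linarith
    · have := mul_le_mul_of_nonneg_left hcle hω.le
      linarith
  | false =>
  rw [h6, cond_false] at h
  cases h7 : Nat.beq (e.angle - c.angle).val 7 with
  | true =>
    rw [h7, cond_true] at h
    have heβ := mul_le_mul_of_nonneg_left he hβ.le
    have h9 := seven e.angle
    rw [angle_eq (k := 7) h7, add_add (show (7 + 3 : Fin 10) = 0 from rfl),
      add_add (show (7 + 7 : Fin 10) = 4 from rfl), add_zero, ← angle_eq (k := 7) h7,
      ← angle_eq (k := 4) h4] at h9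
    have h8 := nonpos h
    simp only [Segment.val_add, Segment.val_mulβ] at h8
    rcases strict_or (k := 7) h7 rfl he' with h10 | h10
    · linarith
    · have := mul_lt_mul_of_pos_left h10 hβ
      linarith
  | false =>
  simp only [h7, cond_false, Bool.and_eq_true] at h
  have h9 := six d.angle
  rw [angle_eq (k := 4) h4, add_add (show (4 + 4 : Fin 10) = 8 from rfl),
    add_add (show (4 + 6 : Fin 10) = 0 from rfl), add_zero, ← angle_eq (k := 4) h4,
    ← angle_eq (k := 8) h.1] at h9
  have h8 := empty h.2
  simp only [Segment.val_add, Segment.val_mulω] at h8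
  split_ifs at h8 with h10
  · have := hc.lt h10
    linarith
  · linarith

/-- A test for disjointness: separation by an edge. -/
def isDisjoint (t : Bool) (L M : List SymSide) : Bool :=
  (L.any fun c => isEmptyWith t c M) || M.any fun c => isEmptyWith t c L

/-- A test for inclusion. -/
def isSubset (t : Bool) (L M : List SymSide) : Bool := M.all fun c => isEmptyWith t c.compl L

section
variable {t : Bool} {s : ℝ} (hs : s ∈ Set.Ioo (0 : ℝ) 1) {L M : List SymSide}
include hs

theorem disjoint_of_isDisjoint (h : isDisjoint t L M = true) :
    Disjoint (polygon t s L) (polygon t s M) := by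
  rw [Set.disjoint_left]
  intro w h1 h2
  rw [mem_polygon] at h1 h2
  simp only [isDisjoint, Bool.or_eq_true, List.any_eq_true] at h
  rcases h with ⟨c, hc, h⟩ | ⟨c, hc, h⟩
  · exact not_sat_of_isEmptyWith hs h h2 (h1 c hc)
  · exact not_sat_of_isEmptyWith hs h h1 (h2 c hc)

theorem subset_of_isSubset (h : isSubset t L M = true) : polygon t s L ⊆ polygon t s M := by
  intro w hw
  rw [mem_polygon] at hw ⊢
  intro c hc
  have := not_sat_of_isEmptyWith hs (List.all_eq_true.1 h c hc) hw
  rwa [SymSide.sat_compl, not_not] at this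

end

/-- Whether the first of two edge conditions with the same normal implies the second. -/
def SymSide.implies (c d : SymSide) : Bool :=
  Nat.beq c.angle.val d.angle.val && (d.bound + -c.bound).isNonneg

/-- Add an edge condition to a list, without conditions that it makes redundant. -/
def insertSide (c : SymSide) (L : List SymSide) : List SymSide :=
  if L.any fun d => d.implies c then L else c :: L.filter fun d => !c.implies d

theorem mem_polygon_insertSide {t : Bool} {s : ℝ} {c : SymSide} {L : List SymSide} {w : ℂ}
    (hc : c.Sat t s w) (hw : w ∈ polygon t s L) : w ∈ polygon t s (insertSide c L) := by
  unfold insertSide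
  split_ifs
  · exact hw
  · rw [mem_polygon, List.forall_mem_cons]
    exact ⟨hc, fun d hd => mem_polygon.1 hw d (List.mem_of_mem_filter hd)⟩

/-- Test `f` for the nonempty parts of the polygon `L` outside the polygon `M`. -/
def testDiff (t : Bool) (f : List SymSide → Bool) : List SymSide → List SymSide → Bool
  | _, [] => true
  | L, c :: M => (isEmptyWith t c.compl L || f (insertSide c.compl L)) &&
      testDiff t f (insertSide c L) M

/-- Test whether the nonempty polygon is covered by the polygons in the list. -/
def isCovered (t : Bool) : List (List SymSide) → List SymSide → Bool
  | [], _ => false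
  | M :: Ms, L =>
    if isDisjoint t L M then isCovered t Ms L else testDiff t (isCovered t Ms) L M

/-- The difference is cut according to the first edge of `M` that fails at the point: each piece
satisfies the earlier edges and the complement of that one, hence is again a polygon. -/
theorem of_testDiff {t : Bool} {s : ℝ} (hs : s ∈ Set.Ioo (0 : ℝ) 1) {w : ℂ}
    {f : List SymSide → Bool} {p : Prop}
    (hf : ∀ L, f L = true → w ∈ polygon t s L → p) {M : List SymSide} :
    ∀ {L}, testDiff t f L M = true → w ∈ polygon t s L → w ∉ polygon t s M → p := by
  induction M with
  | nil => intro L _ _ h; exact absurd (mem_polygon.2 (by simp)) h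
  | cons c M ih =>
    intro L h hw hn
    simp only [testDiff, Bool.and_eq_true, Bool.or_eq_true] at h
    by_cases hc : c.Sat t s w
    · refine ih h.2 (mem_polygon_insertSide hc hw) fun hM => hn ?_
      rw [mem_polygon, List.forall_mem_cons]
      exact ⟨hc, mem_polygon.1 hM⟩
    · have hc' := SymSide.sat_compl.2 hc
      rcases h.1 with h | h
      · exact (not_sat_of_isEmptyWith hs h (mem_polygon.1 hw) hc').elim
      · exact hf _ h (mem_polygon_insertSide hc' hw)

theorem exists_mem_of_isCovered {t : Bool} {s : ℝ} (hs : s ∈ Set.Ioo (0 : ℝ) 1) {w : ℂ}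
    {Ms : List (List SymSide)} : ∀ {L : List SymSide}, isCovered t Ms L = true →
      w ∈ polygon t s L → ∃ M ∈ Ms, w ∈ polygon t s M := by
  induction Ms with
  | nil => intro L h; simp [isCovered] at h
  | cons M Ms ih =>
    intro L h hw
    have ih' : ∀ L, isCovered t Ms L = true → w ∈ polygon t s L →
        ∃ M' ∈ M :: Ms, w ∈ polygon t s M' := fun L h1 h2 =>
      let ⟨M', h3, h4⟩ := ih h1 h2
      ⟨M', List.mem_cons_of_mem _ h3, h4⟩
    rw [isCovered] at h
    split_ifs at h
    · exact ih' L h hw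
    · by_cases hM : w ∈ polygon t s M
      · exact ⟨M, List.mem_cons_self, hM⟩
      · exact of_testDiff hs ih' h hw hM

/-! ### Symbolic similarities -/

/-- The value of the functional `dirDot j` at a vector with given pentagonal coordinates. -/
def coord (j : Fin 10) (p q : Segment) : Segment :=
  (normalCoeff j).1 • p + (normalCoeff j).2 • q

theorem val_coord (j : Fin 10) (p q : Segment) (s : ℝ) :
    (coord j p q).val s = dirDot j (pent (p.val s) (q.val s)) := by
  rw [dirDot_eq, dot_u_zero_pent, dot_u_one_pent]; simp [coord]

/-- A rotation, possibly preceded by the complex conjugation, followed by a scaling and by a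
translation whose pentagonal coordinates are affine in a parameter. -/
structure SymMap where
  conj : Bool
  rot : Fin 5
  scale : GoldenInt
  p : Segment
  q : Segment
deriving DecidableEq

namespace SymMap

/-- The similarity for the parameter `s`; the translations are reversed for `𝓑̃`. -/
noncomputable def toFun (t : Bool) (s : ℝ) (g : SymMap) (w : ℂ) : ℂ :=
  (g.scale.val : ℂ) * (u g.rot * if g.conj then (starRingEnd ℂ) w else w) +
    (sgn t : ℂ) * pent (g.p.val s) (g.q.val s)

/-- The angle of the rotation. -/
def angle (g : SymMap) : Fin 10 := ⟨2 * g.rot.val, by have := g.rot.isLt; omega⟩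

/-- The action on the directions of normals. -/
def dirMap (g : SymMap) (j : Fin 10) : Fin 10 := if g.conj then g.angle - j else j + g.angle

/-- The inverse action on the directions of normals. -/
def dirInv (g : SymMap) (j : Fin 10) : Fin 10 := if g.conj then g.angle - j else j - g.angle

theorem dirInv_dirMap (g : SymMap) (j : Fin 10) : g.dirInv (g.dirMap j) = j := by
  cases h : g.conj <;> simp [dirInv, dirMap, h]

/-- A similarity acts on linear functionals by turning the normal back. Rotations by 72° shift the
angle index by even numbers, and a reflection is its own inverse on directions. -/
theorem dirDot_toFun (t : Bool) (s : ℝ) (g : SymMap) (j : Fin 10) (w : ℂ) :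
    dirDot j (g.toFun t s w) =
      g.scale.val * dirDot (g.dirInv j) w + sgn t * (coord j g.p g.q).val s := by
  have h1 : ∀ (j : Fin 10) (k : Fin 5),
      dirIndex (j - ⟨2 * k.val, by have := k.isLt; omega⟩) = dirIndex j - k ∧
      dirIndex (⟨2 * k.val, by have := k.isLt; omega⟩ - j) = k - dirIndex j ∧
      (j - ⟨2 * k.val, by have := k.isLt; omega⟩).val % 2 = j.val % 2 ∧
      ((⟨2 * k.val, by have := k.isLt; omega⟩ : Fin 10) - j).val % 2 = j.val % 2 := by decide
  obtain ⟨h2, h3, h4, h5⟩ := h1 j g.rot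
  rw [val_coord, toFun]
  simp only [dirDot, dot_add, dot_real_mul, dot_u_mul]
  cases h : g.conj
  · simp only [dirInv, h, angle, dirSign, h2, h4, Bool.false_eq_true, if_false]; ring
  · simp only [dirInv, h, angle, dirSign, h3, h5, if_true, dot_u_conj, neg_sub]; ring

/-- The identity. -/
def id : SymMap := ⟨false, 0, 1, 0, 0⟩

@[simp] theorem toFun_id (t : Bool) (s : ℝ) (w : ℂ) : id.toFun t s w = w := by
  simp [toFun, id]
  right; apply Complex.ext <;> simp [pent]

/-- The composition of symbolic similarities. -/
def comp (g h : SymMap) : SymMap where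
  conj := g.conj ^^ h.conj
  rot := if g.conj then g.rot - h.rot else g.rot + h.rot
  scale := g.scale * h.scale
  p := g.scale • coord (g.dirInv 0) h.p h.q + g.p
  q := g.scale • coord (g.dirInv 2) h.p h.q + g.q

theorem toFun_comp (t : Bool) (s : ℝ) (g h : SymMap) (w : ℂ) :
    (g.comp h).toFun t s w = g.toFun t s (h.toFun t s w) := by
  have hangle : (g.comp h).angle = if g.conj then g.angle - h.angle else g.angle + h.angle := by
    have : ∀ k l : Fin 5,
        ((⟨2 * (k - l).val, by have := (k - l).isLt; omega⟩ : Fin 10) =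
          ⟨2 * k.val, by have := k.isLt; omega⟩ - ⟨2 * l.val, by have := l.isLt; omega⟩) ∧
        ((⟨2 * (k + l).val, by have := (k + l).isLt; omega⟩ : Fin 10) =
          ⟨2 * k.val, by have := k.isLt; omega⟩ + ⟨2 * l.val, by have := l.isLt; omega⟩) := by
      decide
    cases hg : g.conj
    · simpa [angle, comp, hg] using (this g.rot h.rot).2
    · simpa [angle, comp, hg] using (this g.rot h.rot).1
  have hd : ∀ m, (g.comp h).dirInv m = h.dirInv (g.dirInv m) := by
    intro m
    have hc : (g.comp h).conj = (g.conj ^^ h.conj) := rfl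
    rw [dirInv, hangle, hc]
    cases hg : g.conj <;> cases hh : h.conj <;> simp [dirInv, hg, hh] <;> abel
  have h0 : ∀ p q : Segment, (coord 0 p q).val s = p.val s := fun p q => by
    rw [val_coord, dirDot_zero, dot_u_zero_pent]
  have h1 : ∀ p q : Segment, (coord 2 p q).val s = q.val s := fun p q => by
    rw [val_coord, dirDot_two, dot_u_one_pent]
  apply eq_of_dot_eq
  · rw [← dirDot_zero, ← dirDot_zero, dirDot_toFun, dirDot_toFun, dirDot_toFun, hd, h0, h0]
    simp [comp]; ring
  · rw [← dirDot_two, ← dirDot_two, dirDot_toFun, dirDot_toFun, dirDot_toFun, hd, h1, h1]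
    simp [comp]; ring

/-- The image of an edge condition. -/
def mapSide (g : SymMap) (c : SymSide) : SymSide :=
  ⟨g.dirMap c.angle, g.scale • c.bound + coord (g.dirMap c.angle) g.p g.q⟩

/-- The parity of the angle survives both rotations and reflections, so included edges stay included
and excluded ones excluded. -/
theorem sat_mapSide {t : Bool} {s : ℝ} {g : SymMap} (hg : 0 < g.scale.val) {c : SymSide} {w : ℂ} :
    (g.mapSide c).Sat t s (g.toFun t s w) ↔ c.Sat t s w := by
  have e : sgn t * dirDot (g.dirMap c.angle) (g.toFun t s w) =
      g.scale.val * (sgn t * dirDot c.angle w) + (coord (g.dirMap c.angle) g.p g.q).val s := by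
    rw [dirDot_toFun, dirInv_dirMap]
    linear_combination (coord (g.dirMap c.angle) g.p g.q).val s * sgn_mul_self t
  have h1 : (g.mapSide c).isStrict t = c.isStrict t := by
    have : ∀ (j : Fin 10) (k : Fin 5),
        (j + ⟨2 * k.val, by have := k.isLt; omega⟩).val % 2 = j.val % 2 ∧
        ((⟨2 * k.val, by have := k.isLt; omega⟩ : Fin 10) - j).val % 2 = j.val % 2 := by decide
    cases hc : g.conj <;> simp [SymSide.isStrict, mapSide, dirMap, hc, angle, this]
  simp only [SymSide.Sat, h1]
  simp only [mapSide, e, Segment.val_add, Segment.val_smul, add_le_add_iff_right,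
    add_lt_add_iff_right, mul_le_mul_iff_right₀ hg, mul_lt_mul_iff_right₀ hg]

/-- The image of a polygon. -/
def mapPolygon (g : SymMap) (L : List SymSide) : List SymSide := L.map g.mapSide

end SymMap

/-! ### The similarity group -/

theorem mul_u_mem (m : Fin 5) : Equiv.mulLeft₀ (u m) (u_ne_zero m) ∈ similarityGroup :=
  Subgroup.subset_closure (Or.inl ⟨m, fun _ => rfl⟩)

theorem mul_real_mem {η : ℝ} (hη : 0 < η) :
    Equiv.mulLeft₀ (η : ℂ) (Complex.ofReal_ne_zero.2 hη.ne') ∈ similarityGroup :=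
  Subgroup.subset_closure (Or.inr (Or.inr (Or.inr ⟨η, hη, fun _ => rfl⟩)))

theorem conj_mem : (Complex.conjLIE.toEquiv : Equiv.Perm ℂ) ∈ similarityGroup :=
  Subgroup.subset_closure (Or.inr (Or.inl ⟨0, fun z => by simp⟩))

theorem zero_mem_QSqrtFive : (0 : ℝ) ∈ QSqrtFive := ⟨0, 0, by simp⟩

theorem one_mem_QSqrtFive : (1 : ℝ) ∈ QSqrtFive := ⟨1, 0, by simp⟩

/-- Conjugating a translation by a scaling multiplies its vector by the factor. This is needed
because the similarities onto subdomains translate by vectors that vary with the real parameter. -/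
theorem add_real_mul_mem {v : ℂ} (hv : Equiv.addRight v ∈ similarityGroup) (a : ℝ) :
    Equiv.addRight ((a : ℂ) * v) ∈ similarityGroup := by
  have pos : ∀ b : ℝ, 0 < b → Equiv.addRight ((b : ℂ) * v) ∈ similarityGroup := by
    intro b hb
    have h := mul_mem (mul_mem (mul_real_mem hb) hv) (inv_mem (mul_real_mem hb))
    convert h using 1
    ext z
    have hb' : (b : ℂ) ≠ 0 := Complex.ofReal_ne_zero.2 hb.ne'
    simp [Equiv.Perm.inv_def, mul_add, hb']
  rcases lt_trichotomy a 0 with h | h | h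
  · have h' := inv_mem (pos (-a) (neg_pos.2 h))
    convert h' using 1
    ext z
    simp [Equiv.Perm.inv_def]
  · convert one_mem similarityGroup using 1
    ext z
    simp [h]
  · exact pos a h

theorem add_pent_mem (p q : ℝ) : Equiv.addRight (pent p q) ∈ similarityGroup := by
  have h1 : Equiv.addRight (pent 1 0) ∈ similarityGroup := Subgroup.subset_closure
    (Or.inr (Or.inr (Or.inl ⟨1, one_mem_QSqrtFive, 0, zero_mem_QSqrtFive, fun _ => rfl⟩)))
  have h2 : Equiv.addRight (pent 0 1) ∈ similarityGroup := Subgroup.subset_closure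
    (Or.inr (Or.inr (Or.inl ⟨0, zero_mem_QSqrtFive, 1, one_mem_QSqrtFive, fun _ => rfl⟩)))
  convert mul_mem (add_real_mul_mem h2 q) (add_real_mul_mem h1 p) using 1
  ext z
  simp [pent_eq p q, add_assoc]

namespace SymMap

theorem exists_mem_similarityGroup (t : Bool) (s : ℝ) {g : SymMap} (hg : 0 < g.scale.val) :
    ∃ G ∈ similarityGroup, ∀ w, G w = g.toFun t s w := by
  have h1 := mul_mem (add_pent_mem (sgn t * g.p.val s) (sgn t * g.q.val s))
    (mul_mem (mul_real_mem hg) (mul_u_mem g.rot))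
  have hp : pent (sgn t * g.p.val s) (sgn t * g.q.val s) =
      (sgn t : ℂ) * pent (g.p.val s) (g.q.val s) := by
    rw [pent_eq, pent_eq (g.p.val s)]; push_cast; ring
  cases hc : g.conj
  · exact ⟨_, h1, fun w => by simp [toFun, hc, hp, mul_assoc]⟩
  · exact ⟨_, mul_mem h1 conj_mem, fun w => by simp [toFun, hc, hp, mul_assoc]⟩

theorem image_polygon {t : Bool} {s : ℝ} {g : SymMap} (hg : 0 < g.scale.val) (L : List SymSide) :
    g.toFun t s '' polygon t s L = polygon t s (g.mapPolygon L) := by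
  obtain ⟨G, -, hG⟩ := exists_mem_similarityGroup t s hg
  ext w
  obtain ⟨z, rfl⟩ := G.surjective w
  have hinj : Function.Injective (g.toFun t s) := fun a b h => by
    rw [← hG, ← hG] at h; exact G.injective h
  rw [hG, hinj.mem_set_image, mem_polygon, mem_polygon, mapPolygon, List.forall_mem_map]
  exact forall₂_congr fun c _ => (sat_mapSide hg).symm

theorem dist_toFun (t : Bool) (s : ℝ) {g : SymMap} (hg : 0 < g.scale.val) (z w : ℂ) :
    dist (g.toFun t s z) (g.toFun t s w) = g.scale.val * dist z w := by
  rw [dist_eq_norm, dist_eq_norm]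
  have e : g.toFun t s z - g.toFun t s w = (g.scale.val : ℂ) *
      (u g.rot * ((if g.conj then (starRingEnd ℂ) z else z) -
        (if g.conj then (starRingEnd ℂ) w else w))) := by simp only [toFun]; ring
  rw [e, norm_mul, norm_mul, norm_u, one_mul, Complex.norm_real, Real.norm_of_nonneg hg.le]
  congr 1
  cases g.conj
  · simp
  · simp only [if_true]
    rw [← map_sub, Complex.norm_conj]

end SymMap

/-! ### Vertices, tiles and points -/

/-- Whether a weak edge condition holds at a point, for one of the ends of the parameter range. -/
def SymSide.testAt (e : Segment → GoldenInt) (x y : GoldenInt) (c : SymSide) : Bool :=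
  let a := normalCoeff c.angle
  (e c.bound + -(a.1 * x + a.2 * y)).isNonneg

/-- The vertices of a polygon, for one of the ends of the parameter range. -/
def vertices (e : Segment → GoldenInt) (L : List SymSide) : List (GoldenInt × GoldenInt) :=
  L.flatMap fun c => L.filterMap fun d =>
    let a := normalCoeff c.angle
    let b := normalCoeff d.angle
    let det := a.1 * b.2 + -(a.2 * b.1)
    let x := (e c.bound * b.2 + -(e d.bound * a.2)) * det.inv
    let y := (a.1 * e d.bound + -(b.1 * e c.bound)) * det.inv
    if det.isPos && L.all fun f => f.testAt e x y then some (x, y) else none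

/-- A multiple `(n, n x, n y)` of a point of a polygon. -/
def center (L : List SymSide) : ℕ × Segment × Segment :=
  let V := vertices Segment.lo L
  let W := vertices Segment.hi L
  let sum := fun (l : List GoldenInt) => l.foldr (· + ·) 0
  (V.length * W.length,
    ⟨GoldenInt.ofNat W.length * sum (V.map Prod.fst),
      GoldenInt.ofNat V.length * sum (W.map Prod.fst)⟩,
    ⟨GoldenInt.ofNat W.length * sum (V.map Prod.snd),
      GoldenInt.ofNat V.length * sum (W.map Prod.snd)⟩)

/-- The slack of an edge condition at a multiple of a point. -/
def SymSide.slack (c : SymSide) (P : ℕ × Segment × Segment) : Segment :=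
  GoldenInt.ofNat P.1 • c.bound + -coord c.angle P.2.1 P.2.2

/-- The point of which a multiple is given. -/
noncomputable def point (t : Bool) (s : ℝ) (P : ℕ × Segment × Segment) : ℂ :=
  (sgn t : ℂ) * pent (P.2.1.val s / P.1) (P.2.2.val s / P.1)

/-- A test for a strict solution of edge conditions. -/
def hasInterior (L : List SymSide) : Bool :=
  let P := center L
  decide (0 < P.1) && L.all fun c => (c.slack P).isPos

/-- The point is stored as a multiple so that its slack keeps end values in `ℤ[ω]`. -/
theorem val_slack {t : Bool} {s : ℝ} {P : ℕ × Segment × Segment} (hP : 0 < P.1) (c : SymSide) :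
    (c.slack P).val s = P.1 * (c.bound.val s - sgn t * dirDot c.angle (point t s P)) := by
  have hP' : (P.1 : ℝ) ≠ 0 := by exact_mod_cast hP.ne'
  have e : P.1 * (sgn t * dirDot c.angle (point t s P)) = (coord c.angle P.2.1 P.2.2).val s := by
    rw [point, dirDot_real_mul, ← mul_assoc (sgn t), sgn_mul_self, one_mul, dirDot_eq,
      dot_u_zero_pent, dot_u_one_pent, coord]
    simp
    field_simp
  rw [mul_sub, e]
  simp [SymSide.slack, sub_eq_add_neg]

/-- The strict version of an edge condition. -/
def SymSide.StrictSat (t : Bool) (s : ℝ) (c : SymSide) (w : ℂ) : Prop :=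
  sgn t * dirDot c.angle w < c.bound.val s

theorem SymSide.StrictSat.sat {t : Bool} {s : ℝ} {c : SymSide} {w : ℂ} (h : c.StrictSat t s w) :
    c.Sat t s w := by
  unfold Sat
  split_ifs
  exacts [h, le_of_lt h]

/-- The candidate point is built from averages of the vertices computed at the two ends of the
parameter range. No property of these vertices is needed: positivity of the slacks alone certifies
the point. -/
theorem strictSat_of_hasInterior {t : Bool} {s : ℝ} (hs : s ∈ Set.Ioo (0 : ℝ) 1) {L : List SymSide}
    (h : hasInterior L = true) : ∀ c ∈ L, c.StrictSat t s (point t s (center L)) := by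
  simp only [hasInterior, Bool.and_eq_true, decide_eq_true_eq, List.all_eq_true] at h
  intro c hc
  have h1 := Segment.val_of_isPos hs (h.2 c hc)
  rw [val_slack (t := t) h.1] at h1
  have hP : (0 : ℝ) < (center L).1 := by exact_mod_cast h.1
  exact sub_pos.1 (pos_of_mul_pos_right h1 hP.le)

theorem continuous_dirDot (j : Fin 10) : Continuous (dirDot j) := by
  unfold dirDot dot; fun_prop

theorem isOpen_strictSat (t : Bool) (s : ℝ) (L : List SymSide) :
    IsOpen {w | ∀ c ∈ L, c.StrictSat t s w} := by
  have : {w | ∀ c ∈ L, c.StrictSat t s w} = ⋂ c ∈ L.toFinset, {w | c.StrictSat t s w} := by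
    ext w; simp
  rw [this]
  refine isOpen_biInter_finset fun c _ => ?_
  have hc := continuous_dirDot c.angle
  exact isOpen_lt (by fun_prop) (by fun_prop)

theorem interior_nonempty_of_hasInterior {t : Bool} {s : ℝ} (hs : s ∈ Set.Ioo (0 : ℝ) 1)
    {L : List SymSide} (h : hasInterior L = true) : (interior (polygon t s L)).Nonempty :=
  ⟨_, interior_maximal (fun _ hw => mem_polygon.2 fun c hc => (hw c hc).sat)
    (isOpen_strictSat t s L) (strictSat_of_hasInterior hs h)⟩

/-- The parallelogram of points whose first two coordinates have absolute value at most `9`. -/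
def box : List SymSide :=
  [0, 5, 2, 7].map fun j => ⟨j, .const (.ofNat 9)⟩

/-- A test for boundedness. -/
def isBounded (t : Bool) (L : List SymSide) : Bool := isSubset t L box

/-- In pentagonal coordinates the box is the continuous image of a compact square. -/
theorem isBounded_of_isBounded {t : Bool} {s : ℝ} (hs : s ∈ Set.Ioo (0 : ℝ) 1) {L : List SymSide}
    (h : isBounded t L = true) : Bornology.IsBounded (polygon t s L) := by
  have key : polygon t s L ⊆ (fun x : ℝ × ℝ => (x.1 : ℂ) * ((sgn t : ℂ) * pent 1 0) +
      (x.2 : ℂ) * ((sgn t : ℂ) * pent 0 1)) '' (Set.Icc (-9) 9 ×ˢ Set.Icc (-9) 9) := by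
    intro w hw
    have hw1 : w = (((sgn t * dot (u 0) w : ℝ) : ℂ) * ((sgn t : ℂ) * pent 1 0) +
      ((sgn t * dot (u 1) w : ℝ) : ℂ) * ((sgn t : ℂ) * pent 0 1)) := by
      conv_lhs => rw [← pent_dot w, pent_eq]
      have := congrArg (fun x : ℝ => (x : ℂ)) (sgn_mul_self t)
      push_cast at this ⊢
      linear_combination (-(dot (u 0) w : ℂ) * pent 1 0 - (dot (u 1) w : ℂ) * pent 0 1) * this
    refine ⟨(sgn t * dot (u 0) w, sgn t * dot (u 1) w), ?_, hw1.symm⟩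
    have h1 := mem_polygon.1 (subset_of_isSubset hs h hw)
    simp only [box, List.map_cons, List.map_nil, List.forall_mem_cons] at h1
    obtain ⟨h1, h2, h3, h4, -⟩ := h1
    have h1 := h1.le
    have h2 := h2.le
    have h3 := h3.le
    have h4 := h4.le
    have h5 := dirDot_add_five 0 w
    have h6 := dirDot_add_five 2 w
    simp only [Segment.val_const, GoldenInt.val_ofNat, Nat.cast_ofNat] at h1 h2 h3 h4
    rw [show (0 + 5 : Fin 10) = 5 from rfl, add_comm] at h5
    rw [show (2 + 5 : Fin 10) = 7 from rfl, add_comm] at h6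
    rw [eq_neg_of_add_eq_zero_left h5] at h2
    rw [eq_neg_of_add_eq_zero_left h6] at h4
    rw [dirDot_zero] at h1 h2
    rw [dirDot_two] at h3 h4
    simp only [Set.mem_prod, Set.mem_Icc]
    refine ⟨⟨?_, ?_⟩, ?_, ?_⟩ <;> linarith
  refine Bornology.IsBounded.subset (IsCompact.isBounded ?_) key
  refine (isCompact_Icc.prod isCompact_Icc).image ?_
  have h1 := Complex.continuous_ofReal
  fun_prop

/-- A test for being a tile. -/
def isTileTest (t : Bool) (L : List SymSide) : Bool := hasInterior L && isBounded t L

theorem isTile_of_isTileTest {t : Bool} {s : ℝ} (hs : s ∈ Set.Ioo (0 : ℝ) 1) {L : List SymSide}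
    (h : isTileTest t L = true) : IsTile (polygon t s L) := by
  simp only [isTileTest, Bool.and_eq_true] at h
  exact ⟨_, rfl, isBounded_of_isBounded hs h.2, interior_nonempty_of_hasInterior hs h.1⟩

/-- Edge conditions for a single point. -/
def pointSides (t : Bool) (x y : Segment) : List SymSide :=
  let o : Fin 10 := bif t then 0 else 5
  [0, 2, 4, 6, 8].map fun j => ⟨j + o, coord (j + o) x y⟩

theorem polygon_pointSides (t : Bool) (s : ℝ) (x y : Segment) :
    polygon t s (pointSides t x y) = {(sgn t : ℂ) * pent (x.val s) (y.val s)} := by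
  set z : ℂ := (sgn t : ℂ) * pent (x.val s) (y.val s) with hz
  have hval : ∀ j, (coord j x y).val s = sgn t * dirDot j z := by
    intro j
    have := sgn_mul_self t
    rw [val_coord, hz, dirDot_real_mul, ← mul_assoc, this, one_mul]
  have hsat : ∀ (j : Fin 10), j.val % 2 = 0 → ∀ w : ℂ,
      (⟨j + (bif t then 0 else 5), coord (j + (bif t then 0 else 5)) x y⟩ : SymSide).Sat t s w ↔
      dirDot j z ≤ dirDot j w := by
    intro j hj w
    have h1 := dirDot_add_five j z
    have h2 := dirDot_add_five j w
    have h3 : ∀ j : Fin 10, j.val % 2 = 0 → (j + 5).val % 2 = 1 := by decide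
    have h4 := h3 j hj
    cases t
    · have e : (⟨j + 5, coord (j + 5) x y⟩ : SymSide).isStrict false = false := by
        simp [SymSide.isStrict_eq, h4]
      simp only [cond_false, SymSide.Sat, e, hval, sgn, Bool.false_eq_true, if_false, one_mul]
      constructor <;> intro h <;> linarith
    · have e : (⟨j, coord j x y⟩ : SymSide).isStrict true = false := by
        simp [SymSide.isStrict_eq, hj]
      simp only [cond_true, add_zero, SymSide.Sat, e, hval, sgn, Bool.false_eq_true, if_false,
        if_true]
      constructor <;> intro h <;> linarith
  ext w
  simp only [mem_polygon, pointSides, List.map_cons, List.map_nil, List.forall_mem_cons,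
    Set.mem_singleton_iff, List.not_mem_nil, false_imp_iff, implies_true, and_true]
  rw [hsat 0 rfl, hsat 2 rfl, hsat 4 rfl, hsat 6 rfl, hsat 8 rfl]
  refine ⟨fun ⟨h0, h2, h4, h6, h8⟩ => ?_, fun h => by simp [h]⟩
  have hβ : 0 < β := by rw [β_eq]; linarith [one_lt_ω]
  -- The five unit vectors sum to zero, so five weak inequalities in the same sense are equalities.
  have sum : ∀ v : ℂ, dirDot 0 v + dirDot 2 v + dirDot 4 v + dirDot 6 v + dirDot 8 v = 0 := by
    intro v
    simp [dirDot_eq, normalCoeff, GoldenInt.val]; ring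
  have sz := sum z
  have sw := sum w
  apply eq_of_dot_eq
  · rw [← dirDot_zero, ← dirDot_zero]; linarith
  · rw [← dirDot_two, ← dirDot_two]; linarith

/-- A test for edge conditions of a single point. -/
def isPointTest (t : Bool) (L : List SymSide) : Bool :=
  match L with
  -- The coordinates of the point are read off the first two edges, whose normals are `u 0`, `u 1`
  -- if `t` is true and their opposites otherwise.
  | c :: d :: _ => decide (L = bif t then pointSides t c.bound d.bound
      else pointSides t (-c.bound) (-d.bound))
  | _ => false

theorem eq_singleton_of_isPointTest {t : Bool} {L : List SymSide} (h : isPointTest t L = true)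
    (s : ℝ) : ∃ z, polygon t s L = {z} := by
  unfold isPointTest at h
  split at h
  · rw [decide_eq_true_eq] at h
    rw [h]
    cases t <;> exact ⟨_, polygon_pointSides _ _ _ _⟩
  · cases h

/-! ### Piecewise isometries and return times -/

namespace DressedDomain

/-- Disjointness of the atoms makes the choice in `map` immaterial. -/
theorem IsDressed.map_eq {X : DressedDomain} (hX : X.IsDressed) {a : Set ℂ × (ℂ → ℂ)}
    (ha : a ∈ X.atoms) {z : ℂ} (hz : z ∈ a.1) : X.map z = a.2 z := by
  have h : ∃ a ∈ X.atoms, z ∈ a.1 := ⟨a, ha, hz⟩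
  have e : h.choose = a := by
    by_contra hn
    exact Set.disjoint_left.1 (hX.disjoint _ h.choose_spec.1 a ha hn) h.choose_spec.2 hz
  rw [map, dif_pos h, e]

theorem IsReturnTime.unique {X : DressedDomain} {D : Set ℂ} {z : ℂ} {n m : ℕ}
    (hn : X.IsReturnTime D z n) (hm : X.IsReturnTime D z m) : n = m :=
  le_antisymm (not_lt.1 fun h => hn.2.2 m hm.1 h hm.2.1) (not_lt.1 fun h => hm.2.2 n hn.1 h hn.2.1)

end DressedDomain

/-! ### Evaluation of data before use -/

/-- Evaluation of an integer before it is used. -/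
def forceInt {α : Type} (k : ℤ → α) : ℤ → α
  | .ofNat 0 => k (.ofNat 0)
  | .ofNat (.succ m) => k (.ofNat (.succ m))
  | .negSucc 0 => k (.negSucc 0)
  | .negSucc (.succ m) => k (.negSucc (.succ m))

theorem forceInt_eq {α : Type} (k : ℤ → α) (n : ℤ) : forceInt k n = k n := by
  rcases n with (_ | m) | (_ | m) <;> rfl

/-- Evaluation of a polygon before it is used. -/
def forceSides {α : Type} : List SymSide → (List SymSide → α) → α
  | [], k => k []
  | c :: L, k => forceInt (fun a => forceInt (fun b => forceInt (fun a' => forceInt (fun b' =>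
      c.angle.casesOn fun j hj => forceInt (fun _ => forceSides L fun L =>
        k (⟨⟨j, hj⟩, ⟨⟨a, b⟩, ⟨a', b'⟩⟩⟩ :: L)) (.ofNat j))
      c.bound.hi.b) c.bound.hi.a) c.bound.lo.b) c.bound.lo.a

theorem forceSides_eq {α : Type} (L : List SymSide) (k : List SymSide → α) :
    forceSides L k = k L := by
  induction L generalizing k with
  | nil => rfl
  | cons c L ih => simp [forceSides, forceInt_eq, ih]

/-- Evaluation of polygons before they are used. -/
def forcePolygons {α : Type} : List (List SymSide) → (List (List SymSide) → α) → α
  | [], k => k []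
  | L :: Ls, k => forceSides L fun L => forcePolygons Ls fun Ls => k (L :: Ls)

theorem forcePolygons_eq {α : Type} (Ls : List (List SymSide)) (k : List (List SymSide) → α) :
    forcePolygons Ls k = k Ls := by
  induction Ls generalizing k with
  | nil => rfl
  | cons L Ls ih => simp [forcePolygons, forceSides_eq, ih]

/-! ### Symbolic dressed domains -/

/-- A test for pairwise disjointness. -/
def arePairwiseDisjoint (t : Bool) : List (List SymSide) → Bool
  | [] => true
  | L :: Ls => Ls.all (isDisjoint t L) && arePairwiseDisjoint t Ls

theorem pairwise_of_arePairwiseDisjoint {t : Bool} {s : ℝ} (hs : s ∈ Set.Ioo (0 : ℝ) 1)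
    {Ls : List (List SymSide)} (h : arePairwiseDisjoint t Ls = true) :
    Ls.Pairwise fun L M => Disjoint (polygon t s L) (polygon t s M) := by
  induction Ls with
  | nil => exact List.Pairwise.nil
  | cons L Ls ih =>
    simp only [arePairwiseDisjoint, Bool.and_eq_true, List.all_eq_true] at h
    exact List.pairwise_cons.2 ⟨fun M hM => disjoint_of_isDisjoint hs (h.1 M hM), ih h.2⟩

/-- A dressed domain whose polygons and isometries are affine in a parameter. -/
structure SymDomain where
  dom : List SymSide
  atoms : List (List SymSide × SymMap)

namespace SymDomain

/-- The dressed domain for the parameter `s`. -/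
def toDressed (t : Bool) (s : ℝ) (X : SymDomain) : DressedDomain where
  dom := polygon t s X.dom
  atoms := {a | ∃ A ∈ X.atoms, (polygon t s A.1, A.2.toFun t s) = a}

/-- A test for the conditions on a dressed domain. -/
def isDressedTest (t : Bool) (X : SymDomain) : Bool :=
  (X.atoms.all fun A => isTileTest t A.1 && !A.2.conj && decide (A.2.scale = 1) &&
    isSubset t A.1 X.dom && isSubset t (A.2.mapPolygon A.1) X.dom) &&
  arePairwiseDisjoint t (X.atoms.map Prod.fst) && isCovered t (X.atoms.map Prod.fst) X.dom

variable {t : Bool} {s : ℝ} {X : SymDomain}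

theorem rigid_of_isDressedTest (h : X.isDressedTest t = true) {A : List SymSide × SymMap}
    (hA : A ∈ X.atoms) : A.2.conj = false ∧ A.2.scale = 1 := by
  simp only [isDressedTest, Bool.and_eq_true, List.all_eq_true, Bool.not_eq_true',
    decide_eq_true_eq] at h
  exact ⟨(h.1.1 A hA).1.1.1.2, (h.1.1 A hA).1.1.2⟩

theorem isDressed_of_isDressedTest (hs : s ∈ Set.Ioo (0 : ℝ) 1) (h : X.isDressedTest t = true) :
    (X.toDressed t s).IsDressed := by
  have hr := fun {A} => rigid_of_isDressedTest h (A := A)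
  simp only [isDressedTest, Bool.and_eq_true, List.all_eq_true] at h
  obtain ⟨⟨h1, h2⟩, h3⟩ := h
  have h2 := List.pairwise_map.1 (pairwise_of_arePairwiseDisjoint hs h2)
  refine ⟨?_, ?_, ?_, ?_, ?_, ?_⟩
  · exact (X.atoms.finite_toSet).image fun A => (polygon t s A.1, A.2.toFun t s)
  · rintro _ ⟨A, hA, rfl⟩
    exact isTile_of_isTileTest hs (h1 A hA).1.1.1.1
  · rintro _ ⟨A, hA, rfl⟩
    refine ⟨A.2.rot, (sgn t : ℂ) * pent (A.2.p.val s) (A.2.q.val s), funext fun w => ?_⟩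
    simp [SymMap.toFun, rotTrans, hr hA]
  · rintro _ ⟨A, hA, rfl⟩ _ ⟨B, hB, rfl⟩ hne
    have : Std.Symm fun A B : List SymSide × SymMap =>
        Disjoint (polygon t s A.1) (polygon t s B.1) := ⟨fun _ _ h => h.symm⟩
    exact h2.forall hA hB fun e => hne (by rw [e])
  · apply Set.Subset.antisymm
    · refine Set.iUnion₂_subset ?_
      rintro _ ⟨A, hA, rfl⟩
      exact subset_of_isSubset hs (h1 A hA).1.2
    · intro w hw
      obtain ⟨M, hM, hw⟩ := exists_mem_of_isCovered hs h3 hw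
      obtain ⟨A, hA, rfl⟩ := List.mem_map.1 hM
      exact Set.mem_iUnion₂.2 ⟨_, ⟨A, hA, rfl⟩, hw⟩
  · rintro _ ⟨A, hA, rfl⟩
    rw [Set.mapsTo_iff_image_subset]
    change A.2.toFun t s '' polygon t s A.1 ⊆ _
    rw [SymMap.image_polygon (by simp [hr hA])]
    exact subset_of_isSubset hs (h1 A hA).2

/-- The atom with a given index. -/
def atomAt (X : SymDomain) (i : ℕ) : List SymSide × SymMap := X.atoms.getD i ([], SymMap.id)

/-- The successive images of a polygon, for a sequence of indices of atoms. -/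
def itinerary (X : SymDomain) : List ℕ → List SymSide → List (List SymSide)
  | [], _ => []
  | i :: w, L => forceSides L fun L => L :: itinerary X w ((X.atomAt i).2.mapPolygon L)

theorem itinerary_cons (X : SymDomain) (i : ℕ) (w : List ℕ) (L : List SymSide) :
    X.itinerary (i :: w) L = L :: X.itinerary w ((X.atomAt i).2.mapPolygon L) := by
  rw [itinerary, forceSides_eq]

/-- A test for whether the successive images lie in the given atoms. -/
def follows (t : Bool) (X : SymDomain) : List ℕ → List SymSide → Bool
  | [], _ => true
  | i :: w, L => forceSides L fun L => decide (i < X.atoms.length) &&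
      isSubset t L (X.atomAt i).1 && follows t X w ((X.atomAt i).2.mapPolygon L)

theorem follows_cons (t : Bool) (X : SymDomain) (i : ℕ) (w : List ℕ) (L : List SymSide) :
    X.follows t (i :: w) L = (decide (i < X.atoms.length) && isSubset t L (X.atomAt i).1 &&
      X.follows t w ((X.atomAt i).2.mapPolygon L)) := by
  rw [follows, forceSides_eq]

/-- The composition of the isometries of a sequence of atoms. -/
def wordMap (X : SymDomain) : List ℕ → SymMap
  | [] => SymMap.id
  | i :: w => (wordMap X w).comp (X.atomAt i).2

theorem atomAt_mem {i : ℕ} (h : i < X.atoms.length) : X.atomAt i ∈ X.atoms := by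
  rw [atomAt, List.getD_eq_getElem _ _ h]; exact List.getElem_mem h

section
variable (hs : s ∈ Set.Ioo (0 : ℝ) 1) (hX : X.isDressedTest t = true)
include hs hX

theorem map_image_polygon {i : ℕ} {L : List SymSide} (hi : i < X.atoms.length)
    (hL : isSubset t L (X.atomAt i).1 = true) :
    (X.toDressed t s).map '' polygon t s L =
      polygon t s ((X.atomAt i).2.mapPolygon L) := by
  rw [← SymMap.image_polygon (by simp [rigid_of_isDressedTest hX (atomAt_mem hi)])]
  exact Set.image_congr fun z hz => (isDressed_of_isDressedTest hs hX).map_eq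
    ⟨_, atomAt_mem hi, rfl⟩ (subset_of_isSubset hs hL hz)

/-- As long as the images stay inside single atoms, iteration is the application of symbolic
isometries, and the images remain explicit polygons. -/
theorem image_iterate {w : List ℕ} : ∀ {L : List SymSide}, X.follows t w L = true →
    ∀ {k : ℕ}, k < w.length → (∃ M, (X.itinerary w L)[k]? = some M ∧
      (X.toDressed t s).map^[k] '' polygon t s L = polygon t s M) ∧
      ∃ b ∈ (X.toDressed t s).atoms, (X.toDressed t s).map^[k] '' polygon t s L ⊆ b.1 := by
  induction w with
  | nil => intro L _ k hk; simp at hk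
  | cons i w ih =>
    intro L h k hk
    simp only [follows_cons, Bool.and_eq_true, decide_eq_true_eq] at h
    cases k with
    | zero =>
      simp only [Function.iterate_zero, Set.image_id]
      exact ⟨⟨L, by rw [itinerary_cons]; rfl, rfl⟩, _, ⟨_, atomAt_mem h.1.1, rfl⟩,
        subset_of_isSubset hs h.1.2⟩
    | succ k =>
      rw [Function.iterate_succ, Set.image_comp, map_image_polygon hs hX h.1.1 h.1.2,
        itinerary_cons]
      exact ih h.2 (by simpa using hk)

theorem iterate_eq {w : List ℕ} : ∀ {L : List SymSide}, X.follows t w L = true →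
    ∀ z ∈ polygon t s L, (X.toDressed t s).map^[w.length] z = (X.wordMap w).toFun t s z := by
  induction w with
  | nil => intro L _ z _; simp [wordMap]
  | cons i w ih =>
    intro L h z hz
    simp only [follows_cons, Bool.and_eq_true, decide_eq_true_eq] at h
    have h1 : (X.toDressed t s).map z = (X.atomAt i).2.toFun t s z :=
      (isDressed_of_isDressedTest hs hX).map_eq ⟨_, atomAt_mem h.1.1, rfl⟩
        (subset_of_isSubset hs h.1.2 hz)
    have h2 := Set.mem_image_of_mem (X.toDressed t s).map hz
    rw [map_image_polygon hs hX h.1.1 h.1.2] at h2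
    rw [List.length_cons, Function.iterate_succ_apply, ih h.2 _ h2, h1, wordMap,
      SymMap.toFun_comp]

theorem image_iterate_length {w : List ℕ} {L : List SymSide} (h : X.follows t w L = true)
    (hw : (X.wordMap w).scale = 1) :
    (X.toDressed t s).map^[w.length] '' polygon t s L =
      polygon t s ((X.wordMap w).mapPolygon L) := by
  rw [← SymMap.image_polygon (by simp [hw])]
  exact Set.image_congr (iterate_eq hs hX h)

end

theorem length_itinerary {w : List ℕ} : ∀ {L : List SymSide},
    (X.itinerary w L).length = w.length := by
  induction w with
  | nil => intro L; rfl
  | cons i w ih => intro L; simp [itinerary_cons, ih]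

/-- The orbit pieces of a list of polygons with itineraries. -/
def pieces (X : SymDomain) (E : List (List SymSide × List ℕ)) : List (List SymSide) :=
  E.flatMap fun e => X.itinerary e.2 e.1

/-- Pairwise disjointness of the concatenated list of pieces contains two statements: disjointness
within one itinerary and between different ones. -/
theorem orbitsTile (hs : s ∈ Set.Ioo (0 : ℝ) 1) (hX : X.isDressedTest t = true)
    {E : List (List SymSide × List ℕ)} (hE : ∀ e ∈ E, X.follows t e.2 e.1 = true)
    (hd : arePairwiseDisjoint t (X.pieces E) = true) (hc : isCovered t (X.pieces E) X.dom = true) :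
    (X.toDressed t s).OrbitsTile {q | ∃ e ∈ E, (polygon t s e.1, e.2.length) = q} := by
  have hp := pairwise_of_arePairwiseDisjoint hs hd
  rw [pieces, List.pairwise_flatMap] at hp
  have hX' := isDressed_of_isDressedTest hs hX
  refine ⟨?_, ?_⟩
  · rintro _ ⟨e, he, rfl⟩ _ ⟨e', he', rfl⟩ k hk k' hk' hne
    obtain ⟨⟨M, hM, hM'⟩, -⟩ := image_iterate hs hX (hE e he) hk
    obtain ⟨⟨N, hN, hN'⟩, -⟩ := image_iterate hs hX (hE e' he') hk'
    simp only at hk hk'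
    by_cases hee : e = e'
    · subst hee
      have hkk : k ≠ k' := fun h => hne (by rw [h])
      rw [hM', hN']
      have h1 := List.pairwise_iff_getElem.1 (hp.1 e he)
      have hl := length_itinerary (X := X) (w := e.2) (L := e.1)
      obtain ⟨hk1, rfl⟩ := List.getElem?_eq_some_iff.1 hM
      obtain ⟨hk2, rfl⟩ := List.getElem?_eq_some_iff.1 hN
      rcases lt_or_gt_of_ne hkk with h | h
      · exact h1 _ _ hk1 hk2 h
      · exact (h1 _ _ hk2 hk1 h).symm
    · rw [hM', hN']
      have : Std.Symm fun a b : List SymSide × List ℕ => ∀ x ∈ X.itinerary a.2 a.1,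
          ∀ y ∈ X.itinerary b.2 b.1, Disjoint (polygon t s x) (polygon t s y) :=
        ⟨fun a b h x hx y hy => (h y hy x hx).symm⟩
      refine hp.2.forall he he' hee M ?_ N ?_
      · exact List.mem_of_getElem? hM
      · exact List.mem_of_getElem? hN
  · apply Set.Subset.antisymm
    · refine Set.iUnion₂_subset ?_
      rintro _ ⟨e, he, rfl⟩
      refine Set.iUnion₂_subset fun k hk => ?_
      obtain ⟨-, b, hb, hs⟩ := image_iterate hs hX (hE e he) hk
      refine hs.trans ?_
      rw [← hX'.cover]
      exact Set.subset_biUnion_of_mem (u := fun a : Set ℂ × (ℂ → ℂ) => a.1) hb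
    · intro w hw
      obtain ⟨M, hM, hw⟩ := exists_mem_of_isCovered hs hc hw
      obtain ⟨e, he, hM⟩ := List.mem_flatMap.1 hM
      obtain ⟨k, hk, rfl⟩ := List.getElem_of_mem hM
      have hk' := hk
      rw [length_itinerary] at hk'
      obtain ⟨⟨N, hN, hN'⟩, -⟩ := image_iterate hs hX (hE e he) hk'
      rw [List.getElem?_eq_getElem hk, Option.some_inj] at hN
      refine Set.mem_iUnion₂.2 ⟨_, ⟨e, he, rfl⟩, Set.mem_iUnion₂.2 ⟨k, hk', ?_⟩⟩
      rw [hN', ← hN]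
      exact hw

end SymDomain

/-! ### Certificates for renormalization -/

/-- Data for a dressed subdomain of `X`, the image of `Z` under `G`: the itineraries of the atoms
until their return, and periodic polygons with their itineraries. -/
structure Certificate where
  X : SymDomain
  Z : SymDomain
  G : SymMap
  words : List (List ℕ)
  periodic : List (List SymSide × List ℕ)

namespace Certificate

/-- The atoms of the subdomain with their itineraries. -/
def returns (c : Certificate) : List (List SymSide × List ℕ) :=
  (c.Z.atoms.zip c.words).map fun x => (c.G.mapPolygon x.1.1, x.2)

/-- The subdomain. -/
def sub (c : Certificate) : SymDomain where
  dom := c.G.mapPolygon c.Z.dom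
  atoms := c.returns.map fun e => (e.1, c.X.wordMap e.2)

/-- The verification of a certificate. -/
def check (t : Bool) (kindTest : List SymSide → Bool) (c : Certificate) : Bool :=
  c.X.isDressedTest t && c.sub.isDressedTest t && isSubset t c.sub.dom c.X.dom &&
  c.G.scale.isPos && decide (c.words.length = c.Z.atoms.length) &&
  ((c.Z.atoms.zip c.words).all fun x =>
    decide ((c.X.wordMap x.2).comp c.G = c.G.comp x.1.2)) &&
  (c.returns.all fun e => !e.2.isEmpty && c.X.follows t e.2 e.1 &&
    isSubset t ((c.X.wordMap e.2).mapPolygon e.1) c.sub.dom) &&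
  (c.periodic.all fun e => !e.2.isEmpty && c.X.follows t e.2 e.1 &&
    decide ((c.X.wordMap e.2).scale = 1) && kindTest e.1 &&
    isSubset t ((c.X.wordMap e.2).mapPolygon e.1) e.1 &&
    isSubset t e.1 ((c.X.wordMap e.2).mapPolygon e.1)) &&
  forcePolygons (c.X.pieces (c.periodic ++ c.returns)) fun P =>
    arePairwiseDisjoint t P && forceSides c.X.dom (isCovered t P)

/-- The tiling by orbit pieces comes first, as the minimality of the return times rests on its
disjointness. -/
theorem sound {t : Bool} {s : ℝ} (hs : s ∈ Set.Ioo (0 : ℝ) 1) {kindTest : List SymSide → Bool}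
    {kind : Set ℂ → Prop} (hkind : ∀ L, kindTest L = true → kind (polygon t s L))
    {c : Certificate} (h : c.check t kindTest = true) :
    (c.sub.toDressed t s).IsSubdomain (c.X.toDressed t s) ∧
    (c.sub.toDressed t s).Similar (c.Z.toDressed t s) ∧
    (c.X.toDressed t s).ReturnOrbitsTile (c.sub.toDressed t s) kind := by
  simp only [check, forcePolygons_eq, forceSides_eq, Bool.and_eq_true, List.all_eq_true,
    decide_eq_true_eq, Bool.not_eq_true', List.isEmpty_eq_false_iff] at h
  obtain ⟨⟨⟨⟨⟨⟨⟨⟨hX, hY⟩, hYX⟩, hG⟩, hlen⟩, hconj⟩, hret⟩, hper⟩, hdis, hcov⟩ := h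
  have hG := GoldenInt.val_of_isPos hG
  have hX' := SymDomain.isDressed_of_isDressedTest hs hX
  have hY' := SymDomain.isDressed_of_isDressedTest hs hY
  have hfol : ∀ e ∈ c.periodic ++ c.returns, c.X.follows t e.2 e.1 = true := by
    intro e he
    rcases List.mem_append.1 he with he | he
    · exact (hper e he).1.1.1.1.2
    · exact (hret e he).1.2
  have htile := SymDomain.orbitsTile hs hX hfol hdis hcov
  have hatom : ∀ e ∈ c.returns, (polygon t s e.1, (c.X.wordMap e.2).toFun t s) ∈
      (c.sub.toDressed t s).atoms := fun e he =>
    ⟨(e.1, c.X.wordMap e.2), List.mem_map.2 ⟨e, he, rfl⟩, rfl⟩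
  have hscale : ∀ e ∈ c.returns, (c.X.wordMap e.2).scale = 1 := fun e he =>
    (SymDomain.rigid_of_isDressedTest hY
      (List.mem_map.2 ⟨e, he, rfl⟩ : (e.1, c.X.wordMap e.2) ∈ c.sub.atoms)).2
  have hreturn : ∀ e ∈ c.returns, ∀ z ∈ polygon t s e.1,
      (c.X.toDressed t s).IsReturnTime (c.sub.toDressed t s).dom z e.2.length := by
    intro e he z hz
    obtain ⟨⟨h1, h2⟩, h3⟩ := hret e he
    refine ⟨List.length_pos_iff.2 h1, ?_, ?_⟩
    · have := Set.mem_image_of_mem (c.X.toDressed t s).map^[e.2.length] hz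
      rw [SymDomain.image_iterate_length hs hX h2 (hscale e he)] at this
      exact subset_of_isSubset hs h3 this
    -- An earlier return would land in an atom of the subdomain, which is the initial piece of its
    -- own orbit and hence disjoint from every later piece.
    · intro k hk0 hk hmem
      rw [← hY'.cover] at hmem
      obtain ⟨_, ⟨A, hA, rfl⟩, hmem⟩ := Set.mem_iUnion₂.1 hmem
      obtain ⟨e', he', rfl⟩ := List.mem_map.1 hA
      have h4 := htile.1 _ ⟨e, List.mem_append_right _ he, rfl⟩ _
        ⟨e', List.mem_append_right _ he', rfl⟩ k hk 0 (List.length_pos_iff.2 (hret e' he').1.1)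
        (fun h => hk0.ne' (congrArg Prod.snd h))
      exact Set.disjoint_left.1 h4 (Set.mem_image_of_mem _ hz) ⟨_, hmem, rfl⟩
  have hmem_atoms : ∀ a ∈ (c.sub.toDressed t s).atoms, ∃ e ∈ c.returns,
      (polygon t s e.1, (c.X.wordMap e.2).toFun t s) = a := by
    rintro _ ⟨A, hA, rfl⟩
    obtain ⟨e, he, rfl⟩ := List.mem_map.1 hA
    exact ⟨e, he, rfl⟩
  refine ⟨⟨hY', hX', subset_of_isSubset hs hYX, ?_⟩, ?_, ?_⟩
  · intro a ha z hz
    obtain ⟨e, he, rfl⟩ := hmem_atoms a ha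
    exact ⟨_, hreturn e he z hz, SymDomain.iterate_eq hs hX (hret e he).1.2 z hz⟩
  · obtain ⟨G, hGmem, hGeq⟩ := SymMap.exists_mem_similarityGroup t s hG
    have hGfun : (G : ℂ → ℂ) = c.G.toFun t s := funext hGeq
    refine ⟨G, hGmem, ?_⟩
    have hatoms : ∀ A w, (A, w) ∈ c.Z.atoms.zip c.words →
        (polygon t s (c.G.mapPolygon A.1), (c.X.wordMap w).toFun t s) =
          (G '' polygon t s A.1, G ∘ A.2.toFun t s ∘ G.symm) := by
      intro A w hAw
      refine Prod.ext ?_ (funext fun z => ?_)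
      · rw [hGfun, SymMap.image_polygon hG]
      · obtain ⟨y, rfl⟩ := G.surjective z
        -- The return isometry is the conjugate by `G` of the isometry of the corresponding atom of
        -- `Z`, as an identity of symbolic maps.
        have h1 : ((c.X.wordMap w).comp c.G) = c.G.comp A.2 := hconj _ hAw
        simp only [Function.comp_apply, Equiv.symm_apply_apply]
        rw [hGfun, ← SymMap.toFun_comp, ← SymMap.toFun_comp, h1]
    have hdom : (c.sub.toDressed t s).dom = ((c.Z.toDressed t s).transform G).dom := by
      change polygon t s (c.G.mapPolygon c.Z.dom) = G '' polygon t s c.Z.dom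
      rw [hGfun, SymMap.image_polygon hG]
    have hat : (c.sub.toDressed t s).atoms = ((c.Z.toDressed t s).transform G).atoms := by
      ext a
      constructor
      · intro ha
        obtain ⟨e, he, rfl⟩ := hmem_atoms a ha
        obtain ⟨⟨A, w⟩, hx, rfl⟩ := List.mem_map.1 he
        rw [hatoms A w hx]
        exact ⟨_, ⟨A, (List.of_mem_zip hx).1, rfl⟩, rfl⟩
      · rintro ⟨_, ⟨A, hA, rfl⟩, rfl⟩
        obtain ⟨i, hi, rfl⟩ := List.getElem_of_mem hA
        -- Equal lengths guarantee that zipping with the words loses no atom.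
        have hi' : i < c.words.length := hlen ▸ hi
        have hz : (c.Z.atoms[i], c.words[i]) ∈ c.Z.atoms.zip c.words := by
          rw [← List.getElem_zip (h := by simp [hi, hi'])]
          exact List.getElem_mem _
        have := hatom _ (List.mem_map.2 ⟨_, hz, rfl⟩)
        rw [hatoms _ _ hz] at this
        exact this
    cases hS : c.sub.toDressed t s
    cases hT : (c.Z.toDressed t s).transform G
    rw [hS, hT] at hdom hat
    simp_all
  · classical
    let T : Set ℂ × (ℂ → ℂ) → ℕ := fun a =>
      if h : ∃ e ∈ c.returns, (polygon t s e.1, (c.X.wordMap e.2).toFun t s) = a then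
        h.choose.2.length else 0
    have hT : ∀ a ∈ (c.sub.toDressed t s).atoms, ∃ e ∈ c.returns,
        (polygon t s e.1, (c.X.wordMap e.2).toFun t s) = a ∧ T a = e.2.length := by
      intro a ha
      have h := hmem_atoms a ha
      exact ⟨h.choose, h.choose_spec.1, h.choose_spec.2, dif_pos h⟩
    refine ⟨T, {q | ∃ e ∈ c.periodic, (polygon t s e.1, e.2.length) = q}, ?_, ?_, ?_, ?_⟩
    · intro a ha
      obtain ⟨e, he, rfl, hTe⟩ := hT a ha
      rw [hTe]
      exact ⟨fun k hk => (SymDomain.image_iterate hs hX (hret e he).1.2 hk).2, hreturn e he⟩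
    · exact (c.periodic.finite_toSet).image fun e => (polygon t s e.1, e.2.length)
    · rintro _ ⟨e, he, rfl⟩
      obtain ⟨⟨⟨⟨⟨h1, h2⟩, h3⟩, h4⟩, h5⟩, h6⟩ := hper e he
      refine ⟨hkind _ h4, List.length_pos_iff.2 h1,
        fun k hk => (SymDomain.image_iterate hs hX h2 hk).2, ?_⟩
      rw [SymDomain.image_iterate_length hs hX h2 h3]
      exact (subset_of_isSubset hs h5).antisymm (subset_of_isSubset hs h6)
    · convert htile using 1
      ext q
      simp only [Set.mem_union, Set.mem_image, Set.mem_ofPred_eq, List.mem_append]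
      constructor
      · rintro (⟨a, ha, rfl⟩ | ⟨e, he, rfl⟩)
        · obtain ⟨e, he, rfl, hTe⟩ := hT a ha
          exact ⟨e, Or.inr he, by rw [hTe]⟩
        · exact ⟨e, Or.inl he, rfl⟩
      · rintro ⟨e, he | he, rfl⟩
        · exact Or.inr ⟨e, he, rfl⟩
        · refine Or.inl ⟨_, hatom e he, ?_⟩
          obtain ⟨e', he', heq, hTe⟩ := hT _ (hatom e he)
          -- `T` depends on the atom only, so the itinerary it selects might be another one with the
          -- same atom; a common point forces equal lengths.
          obtain ⟨-, -, -, hne⟩ := hY'.isTile _ (hatom e he)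
          obtain ⟨z, hz⟩ := hne.mono interior_subset
          have hz' : z ∈ polygon t s e'.1 := by
            rw [show polygon t s e'.1 = polygon t s e.1 from congrArg Prod.fst heq]; exact hz
          rw [hTe, (hreturn e he z hz).unique (hreturn e' he' z hz')]

end Certificate

/-! ### The base triangles as symbolic dressed domains -/

namespace GoldenInt

/-- The powers of `ω`. -/
def ωPow : ℕ → GoldenInt
  | 0 => 1
  | n + 1 => ⟨0, 1⟩ * ωPow n

/-- The powers of `β`. -/
def βPow : ℕ → GoldenInt
  | 0 => 1
  | n + 1 => ⟨-1, 1⟩ * βPow n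

@[simp] theorem val_ωPow (n : ℕ) : (ωPow n).val = ω ^ n := by
  induction n with
  | zero => simp [ωPow]
  | succ n ih => rw [ωPow, val_mul, ih]; simp [val]; ring

@[simp] theorem val_βPow (n : ℕ) : (βPow n).val = β ^ n := by
  induction n with
  | zero => simp [βPow]
  | succ n ih => rw [βPow, val_mul, ih]; simp [val, β_eq]; ring

end GoldenInt

open GoldenInt

/-- The function `ω ^ m - ω ^ n τ`. -/
def Segment.affine (m n : ℕ) (T : Segment) : Segment := .const (ωPow m) + -(ωPow n • T)

namespace SymDomain

/-- The edges of the base triangle. -/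
def baseSides (T : Segment) : List SymSide := [⟨7, T.affine 2 0⟩, ⟨0, 0⟩, ⟨4, 0⟩]

/-- The edges of the atoms of the base triangle. -/
def atomSides (T : Segment) : List (List SymSide) :=
  [[⟨0, 0⟩, ⟨4, 0⟩, ⟨6, T.affine 1 1⟩],
    [⟨7, T.affine 2 0⟩, ⟨8, T.affine 2 1⟩, ⟨0, 0⟩, ⟨1, -T.affine 1 1⟩, ⟨4, 0⟩],
    [⟨7, T.affine 2 0⟩, ⟨0, 0⟩, ⟨3, -T.affine 2 1⟩]]

/-- The isometries of the atoms of the base triangle. -/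
def atomMaps (T : Segment) : List SymMap :=
  [⟨false, 2, 1, -T.affine 1 1, -T.affine 2 2⟩, ⟨false, 3, 1, 0, -T.affine 3 2⟩,
    ⟨false, 2, 1, -T.affine 1 1 + .const (-ωPow 1), -T.affine 2 2 + .const (-ωPow 2)⟩]

/-- The base triangle. -/
def base (T : Segment) : SymDomain := ⟨baseSides T, (atomSides T).zip (atomMaps T)⟩

/-- The edges of the base triangle without its apex. -/
def puncturedSides (T : Segment) : List SymSide := ⟨1, 0⟩ :: baseSides T

/-- The base triangle without its apex and without the atom of index `i`. -/
def punctured (T : Segment) (i : ℕ) : SymDomain where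
  dom := puncturedSides T
  atoms := ((atomSides T).map (· ++ puncturedSides T)).zip (atomMaps T) |>.eraseIdx i

/-- The domain with the sign of all coordinates and indices changed. -/
def neg (X : SymDomain) : SymDomain where
  dom := X.dom.map fun c => ⟨c.angle + 5, c.bound⟩
  atoms := X.atoms.map fun A =>
    (A.1.map fun c => ⟨c.angle + 5, c.bound⟩, { A.2 with p := -A.2.p, q := -A.2.q })

end SymDomain

/-- The polygon of period one in the first atom. -/
def firstPentagon (T : Segment) : List SymSide :=
  [⟨0, 0⟩, ⟨4, 0⟩, ⟨6, T.affine 1 1⟩, ⟨2, -T.affine 0 0⟩, ⟨8, T.affine 1 1⟩]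

/-- The polygon of period one in the second atom, for small parameters. -/
def innerPentagon (T : Segment) : List SymSide :=
  [⟨7, T.affine 2 0⟩, ⟨1, -T.affine 1 1⟩, ⟨5, .const 1⟩, ⟨9, .const 1⟩, ⟨3, -T.affine 1 1⟩]

/-- The polygon of period one in the second atom, for large parameters. -/
def outerPentagon (T : Segment) : List SymSide :=
  [⟨0, 0⟩, ⟨4, 0⟩, ⟨8, T.affine 2 1⟩, ⟨2, -T.affine 1 0⟩, ⟨6, T.affine 2 1⟩]

/-- A polygon of period five. -/
def smallPentagon (T : Segment) : List SymSide :=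
  [⟨0, 0⟩, ⟨6, T.affine 1 1⟩, ⟨4, .const ⟨1, -1⟩⟩, ⟨8, T.affine 0 1 + .const 1⟩,
    ⟨2, -T.affine 1 0⟩]

/-- The scaling of the base triangle towards its apex. -/
def scaling (n : ℕ) : SymMap := ⟨false, 0, βPow n, 0, 0⟩

/-- A similarity that maps a base triangle onto the third atom, with rotation. -/
def rotationSim (n : ℕ) (T : Segment) : SymMap := ⟨false, 4, βPow n, -T, -T.affine 2 0⟩

/-- A similarity that maps a base triangle onto the third atom, with reflection. -/
def reflectionSim (n : ℕ) (T : Segment) : SymMap := ⟨true, 1, βPow n, -T, -T.affine 2 0⟩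

namespace Certificate

/-- The certificate for `0 < τ < β ^ 2`. -/
def small : Certificate :=
  let T : Segment := ⟨0, βPow 2⟩
  { X := .base T
    Z := .base ⟨0, 1⟩
    G := scaling 2
    words := [[0, 1, 0], [0, 1, 1, 1, 0], [0, 1, 2, 1, 0]]
    periodic := [(firstPentagon T, [0]), (innerPentagon T, [1])] }

/-- The certificate for `β ^ 2 < τ < β`. -/
def medium : Certificate :=
  let T : Segment := ⟨βPow 2, βPow 1⟩
  { X := .base T
    Z := (SymDomain.base ⟨1, 0⟩).neg
    G := reflectionSim 3 T
    words := [[2, 1, 1], [2, 1, 0, 0, 1], [2, 1, 0, 0, 1, 1, 1, 0, 0, 1, 1, 1, 0, 0, 1]]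
    periodic := [(firstPentagon T, [0]), (innerPentagon T ++ outerPentagon T, [1]),
      (smallPentagon T, [0, 0, 1, 1, 1])] }

/-- The certificate for `β < τ < 1`. -/
def large : Certificate :=
  let T : Segment := ⟨βPow 1, 1⟩
  { X := .base T
    Z := (SymDomain.base ⟨1, 0⟩).neg
    G := rotationSim 2 T
    words := [[2], [2, 1, 1], [2, 1, 0, 0, 1]]
    periodic := [(firstPentagon T, [0]), (outerPentagon T, [1])] }

end Certificate

/-- All data are pairs of elements of `ℤ[ω]`, so one finite evaluation per sign covers the whole
open range of parameters. -/
theorem check_small (t : Bool) : Certificate.small.check t (isTileTest t) = true := by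
  revert t; decide +kernel

theorem check_medium (t : Bool) : Certificate.medium.check t (isTileTest t) = true := by
  revert t; decide +kernel

theorem check_large (t : Bool) : Certificate.large.check t (isTileTest t) = true := by
  revert t; decide +kernel

/-! ### Certificates for the limiting cases -/

/-- The edge conditions of the point with the given coordinates. -/
def constPoint (t : Bool) (x y : GoldenInt) : List SymSide := pointSides t (.const x) (.const y)

/-- A test for tiles and single points. -/
def isTileOrPointTest (t : Bool) (L : List SymSide) : Bool := isTileTest t L || isPointTest t L

theorem isTile_or_singleton_of_isTileOrPointTest {t : Bool} {s : ℝ} (hs : s ∈ Set.Ioo (0 : ℝ) 1)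
    {L : List SymSide} (h : isTileOrPointTest t L = true) :
    IsTile (polygon t s L) ∨ ∃ z, polygon t s L = {z} := by
  rw [isTileOrPointTest, Bool.or_eq_true] at h
  exact h.imp (isTile_of_isTileTest hs) fun h => eq_singleton_of_isPointTest h s

namespace Certificate

/-- The certificate for `τ = 0`. -/
def zero : Certificate :=
  let T : Segment := .const 0
  { X := .punctured T 2
    Z := .punctured T 2
    G := scaling 2
    words := [[0, 1, 0], [0, 1, 1, 1, 0]]
    periodic := [(firstPentagon T, [0]), (innerPentagon T, [1])] }

/-- The certificate for `τ = β ^ 2`. -/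
def betaSq (t : Bool) : Certificate :=
  let T : Segment := .const (βPow 2)
  { X := .base T
    Z := (SymDomain.punctured 0 2).neg
    G := ⟨false, 4, βPow 4, .const (-βPow 2), .const (βPow 2 * (1 + -ωPow 2))⟩
    words := [[0, 1, 2, 1, 0], [0, 1, 2, 1, 0, 0, 1, 1, 1, 0, 0, 1, 1, 1, 0]]
    periodic := [(firstPentagon T, [0]), (innerPentagon T ++ outerPentagon T, [1]),
      ([⟨0, 0⟩, ⟨4, 0⟩, ⟨8, .const ⟨2, -1⟩⟩, ⟨2, .const ⟨3, -2⟩⟩, ⟨6, .const ⟨2, -1⟩⟩],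
        [0, 1, 1, 1, 0]),
      if t then (constPoint true 0 0, [0, 1, 0])
      else (constPoint false ⟨-1, 0⟩ ⟨1, -2⟩, [1, 1, 2])] }

/-- The certificate for `τ = β`. -/
def beta (t : Bool) : Certificate :=
  let T : Segment := .const (βPow 1)
  { X := .base T
    Z := (SymDomain.punctured 0 2).neg
    G := reflectionSim 3 T
    words := [[2, 1, 1], [2, 1, 0, 0, 1]]
    periodic := [(firstPentagon T, [0]), (innerPentagon T ++ outerPentagon T, [1]),
      if t then (constPoint true 0 ⟨-1, 0⟩, [0, 0, 1, 1, 1])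
      else (constPoint false ⟨1, -1⟩ ⟨-2, 0⟩, [2])] }

/-- The certificate for `τ = 1`. -/
def one : Certificate :=
  let T : Segment := .const 1
  { X := .punctured T 0
    Z := (SymDomain.punctured 0 2).neg
    G := rotationSim 2 T
    words := [[1], [1, 0, 0]]
    periodic := [(outerPentagon T, [0])] }

end Certificate

theorem check_zero (t : Bool) : Certificate.zero.check t (isTileOrPointTest t) = true := by
  revert t; decide +kernel

/-- Exchanging `𝓑` and `𝓑̃` exchanges included and excluded edges, so the boundary point left over
by the tiles, and its itinerary, depend on `t`. -/
theorem check_betaSq (t : Bool) :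
    (Certificate.betaSq t).check t (isTileOrPointTest t) = true := by
  revert t; decide +kernel

theorem check_beta (t : Bool) : (Certificate.beta t).check t (isTileOrPointTest t) = true := by
  revert t; decide +kernel

theorem check_one (t : Bool) : Certificate.one.check t (isTileOrPointTest t) = true := by
  revert t; decide +kernel

/-! ### The symbolic domains represent the base triangles -/

theorem ω_pos : 0 < ω := by linarith [one_lt_ω]

theorem β_pos : 0 < β := by rw [β_eq]; linarith [one_lt_ω]

@[simp] theorem Segment.val_affine (m n : ℕ) (T : Segment) (s : ℝ) :
    (T.affine m n).val s = ω ^ m - ω ^ n * T.val s := by simp [Segment.affine, sub_eq_add_neg]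

theorem pent_neg (p q : ℝ) : pent (-p) (-q) = -pent p q := by
  rw [pent_eq, pent_eq p]; push_cast; ring

theorem sat_add_five {t : Bool} {s : ℝ} {c : SymSide} {w : ℂ} :
    (⟨c.angle + 5, c.bound⟩ : SymSide).Sat t s w ↔ c.Sat (!t) s w := by
  have h := dirDot_add_five c.angle w
  have e : sgn t * dirDot (c.angle + 5) w = sgn (!t) * dirDot c.angle w := by
    have h : dirDot (c.angle + 5) w = -dirDot c.angle w := by linarith
    rw [h]; cases t <;> simp [sgn]
  have h1 : SymSide.isStrict t ⟨c.angle + 5, c.bound⟩ = c.isStrict (!t) := by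
    have : ∀ (j : Fin 10) (t : Bool), Nat.beq ((j + 5).val % 2) (bif t then 1 else 0) =
        Nat.beq (j.val % 2) (bif !t then 1 else 0) := by decide
    exact this _ _
  simp only [SymSide.Sat, h1, e]

theorem polygon_map_add_five (t : Bool) (s : ℝ) (L : List SymSide) :
    polygon t s (L.map fun c => ⟨c.angle + 5, c.bound⟩) = polygon (!t) s L := by
  ext w
  rw [mem_polygon, mem_polygon, List.forall_mem_map]
  exact forall₂_congr fun c _ => sat_add_five

/-- Lets a certificate for one sign have a target of the opposite sign. -/
theorem SymDomain.toDressed_neg (X : SymDomain) (t : Bool) (s : ℝ) :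
    X.neg.toDressed t s = X.toDressed (!t) s := by
  have h : ∀ g : SymMap, ({ g with p := -g.p, q := -g.q } : SymMap).toFun t s =
      g.toFun (!t) s := by
    intro g; funext w
    simp only [SymMap.toFun, Segment.val_neg, pent_neg]
    cases t <;> simp [sgn]
  rw [toDressed, toDressed, DressedDomain.mk.injEq]
  refine ⟨polygon_map_add_five _ _ _, ?_⟩
  ext a
  simp only [neg, List.mem_map, Set.mem_ofPred_eq, exists_exists_and_eq_and,
    polygon_map_add_five, h]

theorem polygon_baseSides (t : Bool) (s : ℝ) (T : Segment) :
    polygon t s (SymDomain.baseSides T) = tile (signed t (sidesB (T.val s))) := by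
  have h1 : dirIndex 7 = 1 ∧ dirIndex 0 = 0 ∧ dirIndex 4 = 2 := by decide
  simp [polygon, SymDomain.baseSides, SymSide.toSide, sidesB, dirSign, h1]

theorem polygon_atomSides (t : Bool) (s : ℝ) (T : Segment) (i : Fin 3) :
    polygon t s ((SymDomain.atomSides T).get i) = atom t (T.val s) i := by
  have h1 : dirIndex 7 = 1 ∧ dirIndex 0 = 0 ∧ dirIndex 4 = 2 ∧ dirIndex 6 = 3 ∧ dirIndex 8 = 4 ∧
      dirIndex 1 = 3 ∧ dirIndex 3 = 4 := by decide
  fin_cases i <;>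
    simp [polygon, SymDomain.atomSides, SymSide.toSide, sidesAtom, dirSign, h1, atom]

theorem toFun_atomMaps (t : Bool) (s : ℝ) (T : Segment) (i : Fin 3) :
    ((SymDomain.atomMaps T).get i).toFun t s = iso t (T.val s) i := by
  funext w
  have h : ∀ v : ℂ, (sgn t : ℂ) * v = if t then -v else v := by
    intro v; cases t <;> simp [sgn]
  fin_cases i <;>
    simp [SymMap.toFun, SymDomain.atomMaps, iso, rotTrans, rotAtom, transAtom, h]
  all_goals split_ifs <;> (try rw [neg_inj]) <;> congr 1 <;> ring

theorem toDressed_base (t : Bool) (s : ℝ) (T : Segment) :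
    (SymDomain.base T).toDressed t s = base t (T.val s) := by
  rw [SymDomain.toDressed, base, DressedDomain.mk.injEq]
  refine ⟨polygon_baseSides t s T, ?_⟩
  ext a
  simp only [← polygon_atomSides, ← toFun_atomMaps, Set.mem_range, Fin.exists_fin_succ]
  simp [SymDomain.base, SymDomain.atomSides, SymDomain.atomMaps]

/-- The extra functional is `β` times the sum of the two coordinates; on the closed triangle it has
constant sign and vanishes only at the apex. For `𝓑̃` the extra edge is strict and removes the apex.
For `𝓑` it is weak and removes nothing, the apex being excluded already. -/
theorem polygon_puncturedSides (t : Bool) (s : ℝ) (T : Segment) :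
    polygon t s (SymDomain.puncturedSides T) = tile (signed t (sidesB (T.val s))) \ {0} := by
  rw [← polygon_baseSides]
  ext w
  have h1 := dirDot_eq 1 w
  have h0 := dirDot_eq 0 w
  have h4 := dirDot_eq 4 w
  have hw : w = 0 ↔ dot (u 0) w = 0 ∧ dot (u 1) w = 0 :=
    ⟨fun h => by simp [h, dot],
      fun h => eq_of_dot_eq (h.1.trans (by simp [dot])) (h.2.trans (by simp [dot]))⟩
  have hω := one_lt_ω
  simp only [normalCoeff, GoldenInt.val] at h0 h1 h4
  push_cast at h0 h1 h4
  have hβ := β_pos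
  rw [β_eq] at hβ
  simp only [SymDomain.puncturedSides, SymDomain.baseSides, Set.mem_sdiff, mem_polygon,
    List.forall_mem_cons, List.not_mem_nil, false_imp_iff, implies_true, and_true,
    Set.mem_singleton_iff, hw]
  rw [and_comm]
  refine and_congr_right fun H => ?_
  obtain ⟨-, H0, H4⟩ := H
  generalize dot (u 0) w = x at *
  generalize dot (u 1) w = y at *
  cases t
  · simp only [SymSide.Sat, SymSide.isStrict_eq, sgn] at H0 H4 ⊢
    simp at H0 H4 ⊢
    rw [h0] at H0
    rw [h4] at H4
    rw [h1]
    constructor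
    · intro _ h; linarith
    · intro _
      have : y < 0 := by nlinarith
      nlinarith
  · simp only [SymSide.Sat, SymSide.isStrict_eq, sgn] at H0 H4 ⊢
    simp at H0 H4 ⊢
    rw [h0] at H0
    rw [h4] at H4
    rw [h1]
    have hy : 0 ≤ y := by nlinarith
    constructor
    · intro h h2 h3; rw [h2, h3] at h; simp at h
    · intro h
      rcases H0.lt_or_eq with h2 | h2
      · nlinarith
      · have : 0 < y := lt_of_le_of_ne hy fun e => h (by linarith) e.symm
        nlinarith

theorem polygon_append (t : Bool) (s : ℝ) (L M : List SymSide) :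
    polygon t s (L ++ M) = polygon t s L ∩ polygon t s M := by
  ext w
  simp only [mem_polygon, List.forall_mem_append, Set.mem_inter_iff]

theorem toDressed_punctured_two (t : Bool) (s : ℝ) (T : Segment) :
    (SymDomain.punctured T 2).toDressed t s = twoAtom t (T.val s) 2 := by
  rw [SymDomain.toDressed, twoAtom, DressedDomain.mk.injEq]
  refine ⟨polygon_puncturedSides t s T, ?_⟩
  ext a
  simp only [← polygon_atomSides, ← toFun_atomMaps, ← polygon_puncturedSides, ← polygon_append,
    Fin.exists_fin_succ, Set.mem_ofPred_eq]
  simp [SymDomain.punctured, SymDomain.atomSides, SymDomain.atomMaps, eq_comm]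

theorem toDressed_punctured_zero (t : Bool) (s : ℝ) (T : Segment) :
    (SymDomain.punctured T 0).toDressed t s = twoAtom t (T.val s) 0 := by
  rw [SymDomain.toDressed, twoAtom, DressedDomain.mk.injEq]
  refine ⟨polygon_puncturedSides t s T, ?_⟩
  ext a
  simp only [← polygon_atomSides, ← toFun_atomMaps, ← polygon_puncturedSides, ← polygon_append,
    Fin.exists_fin_succ, Set.mem_ofPred_eq]
  simp [SymDomain.punctured, SymDomain.atomSides, SymDomain.atomMaps, eq_comm]

open scoped Pointwise

/-! ### Diameters -/

theorem diam_image_of_dist_eq {c : ℝ} (hc : 0 < c) {f : ℂ → ℂ}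
    (hf : ∀ z w, dist (f z) (f w) = c * dist z w) (S : Set ℂ) :
    Metric.diam (f '' S) = c * Metric.diam S := by
  have hg : Isometry fun z => c⁻¹ • f z := Isometry.of_dist_eq fun z w => by
    rw [dist_smul₀, hf, Real.norm_of_nonneg (inv_nonneg.2 hc.le), inv_mul_cancel_left₀ hc.ne']
  have h := hg.diam_image S
  have e : (fun z => c⁻¹ • f z) '' S = c⁻¹ • (f '' S) := by
    rw [← Set.image_smul, Set.image_image]
  rw [e, diam_smul₀, Real.norm_of_nonneg (inv_nonneg.2 hc.le)] at h
  rw [← h, mul_inv_cancel_left₀ hc.ne']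

theorem dirDot_pent (j : Fin 10) (p q : ℝ) :
    dirDot j (pent p q) = (normalCoeff j).1.val * p + (normalCoeff j).2.val * q := by
  rw [dirDot_eq, dot_u_zero_pent, dot_u_one_pent]

theorem dirDot_add (j : Fin 10) (z w : ℂ) : dirDot j (z + w) = dirDot j z + dirDot j w := by
  rw [dirDot, dot_add, mul_add]; rfl

/-- A polygon with a strict solution of its edge conditions is dense in the closed polygon. -/
theorem closure_polygon {t : Bool} {s : ℝ} {L : List SymSide} {z : ℂ}
    (hz : ∀ c ∈ L, c.StrictSat t s z) :
    closure (polygon t s L) = {w | ∀ c ∈ L, sgn t * dirDot c.angle w ≤ c.bound.val s} := by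
  apply Set.Subset.antisymm
  · refine closure_minimal (fun w hw c hc => (mem_polygon.1 hw c hc).le) ?_
    simp only [Set.ofPred_forall]
    exact isClosed_biInter fun c _ =>
      isClosed_le (continuous_const.mul (continuous_dirDot _)) continuous_const
  · intro w hw
    have h1 : Filter.Tendsto (fun ε : ℝ => ((1 - ε : ℝ) : ℂ) * w + (ε : ℂ) * z)
        (nhdsWithin 0 (Set.Ioi 0)) (nhds w) := by
      have : Continuous fun ε : ℝ => ((1 - ε : ℝ) : ℂ) * w + (ε : ℂ) * z := by fun_prop
      have := this.tendsto 0
      simp only [sub_zero, Complex.ofReal_one, one_mul, Complex.ofReal_zero, zero_mul,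
        add_zero] at this
      exact this.mono_left nhdsWithin_le_nhds
    refine mem_closure_of_tendsto h1 ?_
    filter_upwards [Ioo_mem_nhdsGT (zero_lt_one (α := ℝ))] with ε hε
    rw [mem_polygon]
    intro c hc
    have h2 : sgn t * dirDot c.angle (((1 - ε : ℝ) : ℂ) * w + (ε : ℂ) * z) < c.bound.val s := by
      rw [dirDot_add, dirDot_real_mul, dirDot_real_mul]
      have h3 := hw c hc
      have h4 : sgn t * dirDot c.angle z < c.bound.val s := hz c hc
      nlinarith [mul_le_mul_of_nonneg_left h3 (sub_nonneg.2 hε.2.le),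
        mul_lt_mul_of_pos_left h4 hε.1]
    unfold SymSide.Sat
    split_ifs
    exacts [h2, h2.le]

/-- The closed triangle with the apex `0` and the given altitude. -/
def closedTriangle (b : ℝ) : Set ℂ := {w | dirDot 7 w ≤ b ∧ dirDot 0 w ≤ 0 ∧ dirDot 4 w ≤ 0}

theorem closedTriangle_eq_smul {b : ℝ} (hb : 0 < b) :
    closedTriangle b = b • closedTriangle 1 := by
  ext w
  rw [Set.mem_smul_set_iff_inv_smul_mem₀ hb.ne']
  simp only [closedTriangle, Set.mem_ofPred_eq, Complex.real_smul, dirDot_real_mul]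
  have h : ∀ x, b⁻¹ * x ≤ 0 ↔ x ≤ 0 := fun x =>
    ⟨fun h => by_contra fun hx => h.not_gt (mul_pos (inv_pos.2 hb) (not_le.1 hx)),
      fun h => mul_nonpos_of_nonneg_of_nonpos (inv_pos.2 hb).le h⟩
  rw [h, h, inv_mul_le_iff₀ hb, mul_one]

theorem diam_closedTriangle {b : ℝ} (hb : 0 < b) :
    Metric.diam (closedTriangle b) = b * Metric.diam (closedTriangle 1) := by
  rw [closedTriangle_eq_smul hb, diam_smul₀, Real.norm_of_nonneg hb.le]

theorem diam_closedTriangle_pos : 0 < Metric.diam (closedTriangle 1) := by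
  -- Needed because `Metric.diam` is zero on unbounded sets.
  have hb : Bornology.IsBounded (closedTriangle 1) := by
    rw [Metric.isBounded_iff_subset_closedBall 0]
    refine ⟨‖pent 1 0‖ + ‖pent 0 1‖, fun w ⟨h7, h0, h4⟩ => ?_⟩
    rw [dirDot_eq] at h7 h0 h4
    simp only [normalCoeff, GoldenInt.val] at h7 h0 h4
    push_cast at h7 h0 h4
    have hω := one_lt_ω
    have hω2 := ω_lt_two
    have hx : |dot (u 0) w| ≤ 1 := abs_le.2 ⟨by nlinarith, by linarith⟩
    have hy : |dot (u 1) w| ≤ 1 := abs_le.2 ⟨by linarith, by nlinarith⟩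
    rw [mem_closedBall_zero_iff, ← pent_dot w, pent_eq]
    refine (norm_add_le _ _).trans ?_
    rw [norm_mul, norm_mul, Complex.norm_real, Complex.norm_real, Real.norm_eq_abs,
      Real.norm_eq_abs]
    exact add_le_add (mul_le_of_le_one_left (norm_nonneg _) hx)
      (mul_le_of_le_one_left (norm_nonneg _) hy)
  have h0 : pent 0 0 ∈ closedTriangle 1 := by
    simp [closedTriangle, dirDot_pent]
  have h1 : pent 0 (-1) ∈ closedTriangle 1 := by
    simp [closedTriangle, dirDot_pent, normalCoeff, GoldenInt.val]
    exact one_lt_ω.le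
  refine lt_of_lt_of_le ?_ (Metric.dist_le_diam_of_mem hb h0 h1)
  rw [dist_pos]
  intro h
  have := congrArg (dot (u 1)) h
  rw [dot_u_one_pent, dot_u_one_pent] at this
  norm_num at this

/-- Taking the closure keeps the diameter and erases the difference between included and excluded
edges; the sign is an isometry. The explicit point is interior to the triangle. -/
theorem diam_polygon_of_iff (t : Bool) {s b : ℝ} (hb : 0 < b) {L : List SymSide}
    (h : ∀ z, (∀ c ∈ L, dirDot c.angle z ≤ c.bound.val s) ↔ z ∈ closedTriangle b)
    (hs : ∀ c ∈ L, dirDot c.angle (pent (-b / 3) (-b * 2 / 3)) < c.bound.val s) :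
    Metric.diam (polygon t s L) = b * Metric.diam (closedTriangle 1) := by
  have e : closure (polygon t s L) = (fun z : ℂ => (sgn t : ℂ) * z) '' closedTriangle b := by
    have hz : ∀ c ∈ L, c.StrictSat t s ((sgn t : ℂ) * pent (-b / 3) (-b * 2 / 3)) := fun c hc => by
      rw [SymSide.StrictSat, dirDot_real_mul, ← mul_assoc, sgn_mul_self, one_mul]
      exact hs c hc
    rw [closure_polygon hz]
    ext w
    have hw : (sgn t : ℂ) * ((sgn t : ℂ) * w) = w := by
      rw [← mul_assoc, ← Complex.ofReal_mul, sgn_mul_self]; simp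
    have h1 := h ((sgn t : ℂ) * w)
    simp only [dirDot_real_mul] at h1
    rw [Set.mem_ofPred_eq, h1]
    exact ⟨fun h => ⟨_, h, hw⟩, by
      rintro ⟨v, hv, rfl⟩
      have : (sgn t : ℂ) * ((sgn t : ℂ) * v) = v := by
        rw [← mul_assoc, ← Complex.ofReal_mul, sgn_mul_self]; simp
      simpa only [this] using hv⟩
  have hi : ∀ z w : ℂ, dist ((sgn t : ℂ) * z) ((sgn t : ℂ) * w) = 1 * dist z w := by
    intro z w
    cases t <;> simp [sgn]
  rw [← Metric.diam_closure, e, diam_image_of_dist_eq one_pos hi, one_mul, diam_closedTriangle hb]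

theorem diam_baseSides (t : Bool) (s : ℝ) {T : Segment} (hT : T.val s ≤ 1) :
    Metric.diam (polygon t s (SymDomain.baseSides T)) =
      (ω ^ 2 - T.val s) * Metric.diam (closedTriangle 1) := by
  have hω := one_lt_ω
  have hω2 := ω_lt_two
  have hb : 0 < ω ^ 2 - T.val s := by rw [ω_sq]; linarith
  refine diam_polygon_of_iff t hb (fun z => ?_) ?_
  · simp [SymDomain.baseSides, closedTriangle]
  · simp [SymDomain.baseSides, dirDot_pent, normalCoeff,
      GoldenInt.val]
    have hd : T.val s - ω ^ 2 < 0 := by linarith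
    -- That is, `β > 1 / 2`, which puts the point strictly inside the edge with normal 4.
    have hω3 : 3 / 2 < ω := by nlinarith [ω_sq]
    generalize he : T.val s - ω ^ 2 = d at *
    refine ⟨?_, ?_, ?_⟩ <;> nlinarith

theorem diam_puncturedSides (t : Bool) (s : ℝ) {T : Segment} (hT : T.val s ≤ 1) :
    Metric.diam (polygon t s (SymDomain.puncturedSides T)) =
      (ω ^ 2 - T.val s) * Metric.diam (closedTriangle 1) := by
  have hω := one_lt_ω
  have hω2 := ω_lt_two
  have hb : 0 < ω ^ 2 - T.val s := by rw [ω_sq]; linarith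
  refine diam_polygon_of_iff t hb (fun z => ?_) ?_
  · simp [SymDomain.puncturedSides, SymDomain.baseSides, closedTriangle]
    intro _
    simp only [dirDot_eq, normalCoeff, GoldenInt.val]
    push_cast
    intro h0 h4
    have : dot (u 1) z ≤ 0 := by nlinarith
    nlinarith
  · simp [SymDomain.puncturedSides, SymDomain.baseSides, dirDot_pent,
      normalCoeff, GoldenInt.val]
    have hd : T.val s - ω ^ 2 < 0 := by linarith
    have hω3 : 3 / 2 < ω := by nlinarith [ω_sq]
    generalize he : T.val s - ω ^ 2 = d at *
    refine ⟨?_, ?_, ?_, ?_⟩ <;> nlinarith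

theorem Certificate.diam_sub {c : Certificate} (t : Bool) (s : ℝ) (hG : 0 < c.G.scale.val) :
    Metric.diam (c.sub.toDressed t s).dom =
      c.G.scale.val * Metric.diam (c.Z.toDressed t s).dom := by
  change Metric.diam (polygon t s (c.G.mapPolygon c.Z.dom)) = _
  rw [← SymMap.image_polygon hG]
  exact diam_image_of_dist_eq hG (SymMap.dist_toFun t s hG) _

/-! ### The renormalization function -/

theorem three_halves_lt_ω : 3 / 2 < ω := by nlinarith [ω_sq, one_lt_ω, ω_lt_two]

theorem β_sq : β ^ 2 = 2 - ω := by rw [β_eq]; linear_combination ω_sq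

theorem ω_cube : ω ^ 3 = 2 * ω + 1 := by linear_combination (ω + 1) * ω_sq

theorem β_sq_pos : 0 < β ^ 2 := by rw [β_sq]; linarith [ω_lt_two]

theorem β_sq_lt_β : β ^ 2 < β := by rw [β_sq, β_eq]; linarith [three_halves_lt_ω]

theorem β_lt_one : β < 1 := by rw [β_eq]; linarith [ω_lt_two]

theorem β_sq_mul_ω_sq : β ^ 2 * ω ^ 2 = 1 := by rw [← mul_pow, β_mul_ω, one_pow]

theorem β_cube_mul_ω_cube : β ^ 3 * ω ^ 3 = 1 := by rw [← mul_pow, β_mul_ω, one_pow]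

theorem ω_cube_mul : ω ^ 3 * (β - β ^ 2) = 1 := by
  rw [ω_cube, β_sq, β_eq]; linear_combination 4 * ω_sq

theorem r_of_lt_β_sq {τ : ℝ} (h0 : 0 < τ) (h1 : τ < β ^ 2) : r τ = ω ^ 2 * τ := by
  rw [r, if_pos ⟨h0, h1⟩]

theorem r_of_lt_β {τ : ℝ} (h0 : β ^ 2 < τ) (h1 : τ < β) : r τ = ω ^ 3 * (β - τ) := by
  rw [r, if_neg fun h => h.2.not_gt h0, if_pos ⟨h0, h1⟩]

theorem r_of_lt_one {τ : ℝ} (h0 : β < τ) (h1 : τ < 1) : r τ = ω ^ 2 * (1 - τ) := by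
  rw [r, if_neg fun h => h.2.not_gt (β_sq_lt_β.trans h0), if_neg fun h => h.2.not_gt h0,
    if_pos ⟨h0, h1⟩]

theorem r_eq_zero {τ : ℝ} (h : τ ∈ ({0, β ^ 2, β, 1} : Set ℝ)) : r τ = 0 := by
  have h1 := β_sq_pos
  have h2 := β_sq_lt_β
  have h3 := β_lt_one
  rw [r, if_neg, if_neg, if_neg]
  all_goals
    rintro ⟨h4, h5⟩
    rcases h with rfl | rfl | rfl | rfl <;> linarith

theorem r_mem_Ioo_of_lt_β_sq {τ : ℝ} (h0 : 0 < τ) (h1 : τ < β ^ 2) : r τ ∈ Set.Ioo (0 : ℝ) 1 := by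
  have hω : 0 < ω ^ 2 := pow_pos ω_pos 2
  rw [r_of_lt_β_sq h0 h1]
  exact ⟨by positivity, by nlinarith [β_sq_mul_ω_sq]⟩

theorem r_mem_Ioo_of_lt_β {τ : ℝ} (h0 : β ^ 2 < τ) (h1 : τ < β) : r τ ∈ Set.Ioo (0 : ℝ) 1 := by
  have hω : 0 < ω ^ 3 := pow_pos ω_pos 3
  rw [r_of_lt_β h0 h1]
  exact ⟨mul_pos hω (sub_pos.2 h1), by nlinarith [ω_cube_mul]⟩

theorem r_mem_Ioo_of_lt_one {τ : ℝ} (h0 : β < τ) (h1 : τ < 1) : r τ ∈ Set.Ioo (0 : ℝ) 1 := by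
  have hω : 0 < ω ^ 2 := pow_pos ω_pos 2
  rw [r_of_lt_one h0 h1]
  have h : ω ^ 2 * (1 - β) = 1 := by rw [β_eq]; linear_combination (2 - ω) * ω_sq - ω_sq
  exact ⟨mul_pos hω (sub_pos.2 h1), by nlinarith⟩

/-! ### Renormalization for generic parameters -/

theorem Certificate.renormalizes {c : Certificate} {t : Bool} {s : ℝ} (hs : s ∈ Set.Ioo (0 : ℝ) 1)
    (h : c.check t (isTileTest t) = true) (hG : 0 < c.G.scale.val) {D : Set ℂ}
    (hD : polygon t s c.sub.dom = D) {a : ℝ}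
    (ha : c.G.scale.val * Metric.diam (c.Z.toDressed t s).dom =
      a * Metric.diam (c.X.toDressed t s).dom) :
    Renormalizes (c.X.toDressed t s) (c.Z.toDressed t s) D a := by
  obtain ⟨h1, h2, h3⟩ := c.sound hs (fun _ => isTile_of_isTileTest hs) h
  exact ⟨_, hD, h1, h2, by rw [diam_sub t s hG, ha], h3⟩

theorem diam_base (t : Bool) {τ : ℝ} (hτ : τ ≤ 1) :
    Metric.diam (base t τ).dom = (ω ^ 2 - τ) * Metric.diam (closedTriangle 1) := by
  -- The diameter formula does not require `s` in the unit interval, so `s = τ` serves.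
  have h : ∃ (T : Segment) (s : ℝ), T.val s = τ :=
    ⟨⟨0, 1⟩, τ, by simp [Segment.val]⟩
  obtain ⟨T, s, rfl⟩ := h
  rw [← diam_baseSides t s hτ, ← toDressed_base]
  rfl

theorem polygon_eq_of_isSubset {t : Bool} {s : ℝ} (hs : s ∈ Set.Ioo (0 : ℝ) 1)
    {L M : List SymSide} (h : (isSubset t L M && isSubset t M L) = true) :
    polygon t s L = polygon t s M := by
  rw [Bool.and_eq_true] at h
  exact (subset_of_isSubset hs h.1).antisymm (subset_of_isSubset hs h.2)

/-- The parameter is `s = r τ`. Scaling by `β ^ 2` turns the altitude `ω ^ 2 - r τ` into `1 - τ`,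
which gives both the domain and the factor. -/
theorem renormalizes_of_lt_β_sq (t : Bool) {τ : ℝ} (h0 : 0 < τ) (h1 : τ < β ^ 2) :
    Renormalizes (base t τ) (base t (r τ)) (tile (signed t (sidesSub τ)))
      ((1 - τ) / (ω ^ 2 - τ)) := by
  have hr := r_mem_Ioo_of_lt_β_sq h0 h1
  have h2 := β_lt_one
  have h3 := β_sq_lt_β
  have h4 := one_lt_ω
  have hT : Segment.val (r τ) ⟨0, βPow 2⟩ = τ := by
    simp only [Segment.val, val_zero, val_βPow, r_of_lt_β_sq h0 h1]
    linear_combination τ * β_sq_mul_ω_sq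
  have hZ : Segment.val (r τ) ⟨0, 1⟩ = r τ := by simp [Segment.val]
  have := Certificate.renormalizes (D := tile (signed t (sidesSub τ)))
    (a := (1 - τ) / (ω ^ 2 - τ)) hr (check_small t) ?_ ?_ ?_
  · simpa only [Certificate.small, toDressed_base, hT, hZ] using this
  · simpa [Certificate.small, scaling] using pow_pos β_pos 2
  · rw [polygon_eq_of_isSubset (M := [⟨7, Segment.affine 0 0 ⟨0, βPow 2⟩⟩, ⟨0, 0⟩, ⟨4, 0⟩]) hr
      (by revert t; decide +kernel)]
    have h5 : dirIndex 7 = 1 ∧ dirIndex 0 = 0 ∧ dirIndex 4 = 2 := by decide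
    simp [polygon, SymSide.toSide, sidesSub, dirSign, h5, hT]
  · simp only [Certificate.small, toDressed_base, hT, hZ, scaling, val_βPow]
    rw [diam_base t hr.2.le, diam_base t (by linarith), ← mul_assoc, ← mul_assoc,
      div_mul_cancel₀ _ (by rw [ω_sq]; linarith), r_of_lt_β_sq h0 h1]
    congr 1
    linear_combination (1 - τ) * β_sq_mul_ω_sq

/-- Here `r` decreases, so the parameter is `s = 1 - r τ`. The altitude of the image is `β ^ 3 * (ω
^ 2 - r τ) = τ`. -/
theorem renormalizes_of_lt_β (t : Bool) {τ : ℝ} (h0 : β ^ 2 < τ) (h1 : τ < β) :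
    Renormalizes (base t τ) (base (!t) (r τ)) (atom t τ 2) (τ / (ω ^ 2 - τ)) := by
  have hr := r_mem_Ioo_of_lt_β h0 h1
  have h2 := β_lt_one
  have h3 := β_sq_pos
  have h4 := one_lt_ω
  have hs : 1 - r τ ∈ Set.Ioo (0 : ℝ) 1 := ⟨by linarith [hr.2], by linarith [hr.1]⟩
  have e := r_of_lt_β h0 h1
  have hT : Segment.val (1 - r τ) ⟨βPow 2, βPow 1⟩ = τ := by
    simp only [Segment.val, val_βPow, e]
    linear_combination (τ - β) * ω_cube_mul
  have hZ : Segment.val (1 - r τ) ⟨1, 0⟩ = r τ := by simp [Segment.val]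
  have := Certificate.renormalizes (D := atom t τ 2)
    (a := τ / (ω ^ 2 - τ)) hs (check_medium t) ?_ ?_ ?_
  · simpa only [Certificate.medium, SymDomain.toDressed_neg, toDressed_base, hT, hZ] using this
  · simpa [Certificate.medium, reflectionSim] using pow_pos β_pos 3
  · rw [polygon_eq_of_isSubset (M := (SymDomain.atomSides ⟨βPow 2, βPow 1⟩).get (2 : Fin 3)) hs
      (by revert t; decide +kernel)]
    exact (polygon_atomSides _ _ _ 2).trans (by rw [hT])
  · simp only [Certificate.medium, SymDomain.toDressed_neg, toDressed_base, hT, hZ,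
      reflectionSim, val_βPow]
    rw [diam_base _ hr.2.le, diam_base t (by linarith), ← mul_assoc, ← mul_assoc,
      div_mul_cancel₀ _ (by rw [ω_sq]; linarith), e]
    congr 1
    linear_combination (τ - β) * β_cube_mul_ω_cube + β * (β_sq_mul_ω_sq)

/-- Again `s = 1 - r τ`, and the altitude of the image is `β ^ 2 * (ω ^ 2 - r τ) = τ`. -/
theorem renormalizes_of_lt_one (t : Bool) {τ : ℝ} (h0 : β < τ) (h1 : τ < 1) :
    Renormalizes (base t τ) (base (!t) (r τ)) (atom t τ 2) (τ / (ω ^ 2 - τ)) := by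
  have hr := r_mem_Ioo_of_lt_one h0 h1
  have h4 := one_lt_ω
  have hs : 1 - r τ ∈ Set.Ioo (0 : ℝ) 1 := ⟨by linarith [hr.2], by linarith [hr.1]⟩
  have e := r_of_lt_one h0 h1
  have hT : Segment.val (1 - r τ) ⟨βPow 1, 1⟩ = τ := by
    simp only [Segment.val, val_βPow, val_one, e, ω_sq, β_eq]
    linear_combination (τ - 1) * ω_sq * (-1)
  have hZ : Segment.val (1 - r τ) ⟨1, 0⟩ = r τ := by simp [Segment.val]
  have := Certificate.renormalizes (D := atom t τ 2)
    (a := τ / (ω ^ 2 - τ)) hs (check_large t) ?_ ?_ ?_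
  · simpa only [Certificate.large, SymDomain.toDressed_neg, toDressed_base, hT, hZ] using this
  · simpa [Certificate.large, rotationSim] using pow_pos β_pos 2
  · rw [polygon_eq_of_isSubset (M := (SymDomain.atomSides ⟨βPow 1, 1⟩).get (2 : Fin 3)) hs
      (by revert t; decide +kernel)]
    exact (polygon_atomSides _ _ _ 2).trans (by rw [hT])
  · simp only [Certificate.large, SymDomain.toDressed_neg, toDressed_base, hT, hZ,
      rotationSim, val_βPow]
    rw [diam_base _ hr.2.le, diam_base t h1.le, ← mul_assoc, ← mul_assoc,
      div_mul_cancel₀ _ (by rw [ω_sq]; linarith), e]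
    congr 1
    linear_combination τ * β_sq_mul_ω_sq

/-! ### Renormalization for the limiting parameters -/

theorem Certificate.renormalizesLimit {c : Certificate} {t : Bool}
    (h : c.check t (isTileOrPointTest t) = true) (hG : 0 < c.G.scale.val)
    (hd : c.G.scale.val * Metric.diam (c.Z.toDressed t (1 / 2)).dom <
      Metric.diam (c.X.toDressed t (1 / 2)).dom) :
    RenormalizesLimit (c.X.toDressed t (1 / 2)) (c.Z.toDressed t (1 / 2)) := by
  -- The limiting certificates have constant data; any parameter in the open interval would do.
  have hs : (1 / 2 : ℝ) ∈ Set.Ioo (0 : ℝ) 1 := by norm_num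
  obtain ⟨h1, h2, h3⟩ := c.sound hs (kind := fun P => IsTile P ∨ ∃ z, P = {z})
    (fun _ => isTile_or_singleton_of_isTileOrPointTest hs) h
  exact ⟨_, h1, h2, by rwa [diam_sub t _ hG], h3⟩

theorem diam_twoAtom (t : Bool) {τ : ℝ} (hτ : τ ≤ 1) (i : Fin 3) :
    Metric.diam (twoAtom t τ i).dom = (ω ^ 2 - τ) * Metric.diam (closedTriangle 1) := by
  have h : ∃ (T : Segment) (s : ℝ), T.val s = τ :=
    ⟨⟨0, 1⟩, τ, by simp [Segment.val]⟩
  obtain ⟨T, s, rfl⟩ := h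
  rw [← diam_puncturedSides t s hτ, polygon_puncturedSides]
  rfl

theorem baseExt_zero (t : Bool) : baseExt t 0 = twoAtom t 0 2 := if_pos rfl

theorem baseExt_one (t : Bool) : baseExt t 1 = twoAtom t 1 0 := by simp [baseExt]

theorem baseExt_of_mem_Ioo (t : Bool) {τ : ℝ} (hτ : τ ∈ Set.Ioo (0 : ℝ) 1) :
    baseExt t τ = base t τ := by
  rw [baseExt, if_neg hτ.1.ne', if_neg hτ.2.ne]

theorem renormalizesLimit_zero (t : Bool) : RenormalizesLimit (baseExt t 0) (baseExt t 0) := by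
  have hκ := diam_closedTriangle_pos
  have := Certificate.renormalizesLimit (check_zero t) ?_ ?_
  · simpa only [Certificate.zero, toDressed_punctured_two, Segment.val_const, val_zero,
      baseExt_zero] using this
  · simpa [Certificate.zero, scaling] using pow_pos β_pos 2
  · simp only [Certificate.zero, toDressed_punctured_two, Segment.val_const, val_zero, scaling,
      val_βPow, diam_twoAtom _ zero_le_one]
    have h2 : β ^ 2 < 1 := β_sq_lt_β.trans β_lt_one
    have h3 : 0 < ω ^ 2 := pow_pos ω_pos 2
    nlinarith [mul_pos h3 hκ]

theorem renormalizesLimit_one (t : Bool) :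
    RenormalizesLimit (baseExt t 1) (baseExt (!t) 0) := by
  have hκ := diam_closedTriangle_pos
  have := Certificate.renormalizesLimit (check_one t) ?_ ?_
  · simpa only [Certificate.one, toDressed_punctured_two, toDressed_punctured_zero,
      SymDomain.toDressed_neg, Segment.val_const, Segment.val_zero, val_one,
      baseExt_zero, baseExt_one] using this
  · simpa [Certificate.one, rotationSim] using pow_pos β_pos 2
  · simp only [Certificate.one, toDressed_punctured_two, toDressed_punctured_zero,
      SymDomain.toDressed_neg, Segment.val_const, Segment.val_zero, val_one, rotationSim,
      val_βPow, diam_twoAtom _ zero_le_one, diam_twoAtom _ le_rfl]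
    have h2 : β ^ 2 * (ω ^ 2 - 0) = 1 := by linear_combination β_sq_mul_ω_sq
    have h3 : 1 < ω ^ 2 - 1 := by rw [ω_sq]; linarith [one_lt_ω]
    rw [← mul_assoc, h2]
    exact mul_lt_mul_of_pos_right h3 hκ

theorem renormalizesLimit_β (t : Bool) :
    RenormalizesLimit (baseExt t β) (baseExt (!t) 0) := by
  have hκ := diam_closedTriangle_pos
  have := Certificate.renormalizesLimit (check_beta t) ?_ ?_
  · simpa only [Certificate.beta, toDressed_punctured_two, toDressed_base,
      SymDomain.toDressed_neg, Segment.val_const, Segment.val_zero, val_βPow, pow_one,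
      baseExt_zero, baseExt_of_mem_Ioo t ⟨β_pos, β_lt_one⟩] using this
  · simpa [Certificate.beta, reflectionSim] using pow_pos β_pos 3
  · simp only [Certificate.beta, toDressed_punctured_two, toDressed_base,
      SymDomain.toDressed_neg, Segment.val_const, Segment.val_zero, reflectionSim,
      val_βPow, pow_one, diam_twoAtom _ zero_le_one, diam_base _ β_lt_one.le]
    have h2 : β ^ 3 * (ω ^ 2 - 0) = β := by linear_combination β * β_sq_mul_ω_sq
    have h3 : β < ω ^ 2 - β := by rw [ω_sq, β_eq]; linarith [ω_lt_two]
    rw [← mul_assoc, h2]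
    exact mul_lt_mul_of_pos_right h3 hκ

theorem renormalizesLimit_β_sq (t : Bool) :
    RenormalizesLimit (baseExt t (β ^ 2)) (baseExt (!t) 0) := by
  have hκ := diam_closedTriangle_pos
  have hβ := β_sq_lt_β.trans β_lt_one
  have := Certificate.renormalizesLimit (check_betaSq t) ?_ ?_
  · simpa only [Certificate.betaSq, toDressed_punctured_two, toDressed_base,
      SymDomain.toDressed_neg, Segment.val_const, Segment.val_zero, val_βPow,
      baseExt_zero, baseExt_of_mem_Ioo t ⟨β_sq_pos, hβ⟩] using this
  · simpa [Certificate.betaSq] using pow_pos β_pos 4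
  · simp only [Certificate.betaSq, toDressed_punctured_two, toDressed_base,
      SymDomain.toDressed_neg, Segment.val_const, Segment.val_zero,
      val_βPow, diam_twoAtom _ zero_le_one, diam_base _ hβ.le]
    have h2 : β ^ 4 * (ω ^ 2 - 0) = β ^ 2 := by linear_combination β ^ 2 * β_sq_mul_ω_sq
    have h3 : β ^ 2 < ω ^ 2 - β ^ 2 := by rw [ω_sq, β_sq]; linarith [three_halves_lt_ω]
    rw [← mul_assoc, h2]
    exact mul_lt_mul_of_pos_right h3 hκ

/-! ### Self-similarity -/

/-- The field `ℚ(√5)`. -/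
def fieldQSqrtFive : Subfield ℝ where
  carrier := QSqrtFive
  mul_mem' := by
    rintro _ _ ⟨a, b, rfl⟩ ⟨c, d, rfl⟩
    refine ⟨a * c + 5 * b * d, a * d + b * c, ?_⟩
    push_cast
    linear_combination (b * d : ℝ) * sqrt_five_sq
  one_mem' := one_mem_QSqrtFive
  add_mem' := by
    rintro _ _ ⟨a, b, rfl⟩ ⟨c, d, rfl⟩
    exact ⟨a + c, b + d, by push_cast; ring⟩
  zero_mem' := zero_mem_QSqrtFive
  neg_mem' := by
    rintro _ ⟨a, b, rfl⟩
    exact ⟨-a, -b, by push_cast; ring⟩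
  inv_mem' := by
    rintro _ ⟨a, b, rfl⟩
    by_cases h : (a : ℝ) + b * √5 = 0
    · rw [h, inv_zero]; exact zero_mem_QSqrtFive
    -- The norm vanishes only at zero because `√5` is irrational.
    · have hn : a ^ 2 - 5 * b ^ 2 ≠ 0 := by
        intro hn
        have hirr : Irrational √5 := (by norm_num : Nat.Prime 5).irrational_sqrt
        have hn' : ((a : ℝ) + b * √5) * (a - b * √5) = 0 := by
          have : (a : ℝ) ^ 2 - 5 * b ^ 2 = 0 := by exact_mod_cast hn
          linear_combination this - (b : ℝ) ^ 2 * sqrt_five_sq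
        have h1 := (mul_eq_zero.1 hn').resolve_left h
        by_cases hb : b = 0
        · subst hb
          have : (a : ℝ) = 0 := by simpa using h1
          exact h (by simp [this])
        · refine hirr ⟨a / b, ?_⟩
          have hb' : (b : ℝ) ≠ 0 := by exact_mod_cast hb
          push_cast
          rw [div_eq_iff hb']
          linarith
      have hn' : (a : ℝ) ^ 2 - 5 * b ^ 2 ≠ 0 := by exact_mod_cast hn
      refine ⟨a / (a ^ 2 - 5 * b ^ 2), -b / (a ^ 2 - 5 * b ^ 2), ?_⟩
      refine inv_eq_of_mul_eq_one_right ?_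
      push_cast
      rw [div_mul_eq_mul_div, ← add_div, ← mul_div_assoc, div_eq_one_iff_eq hn']
      linear_combination (-(b : ℝ) ^ 2) * sqrt_five_sq

theorem ω_mem : ω ∈ fieldQSqrtFive := ⟨1 / 2, 1 / 2, by unfold ω; push_cast; ring⟩

theorem β_mem : β ∈ fieldQSqrtFive := by rw [β_eq]; exact sub_mem ω_mem (one_mem _)

/-- The branches of the renormalization function. -/
theorem r_cases (τ : ℝ) :
    (0 < τ ∧ τ < β ^ 2 ∧ r τ = ω ^ 2 * τ) ∨ (β ^ 2 < τ ∧ τ < β ∧ r τ = ω ^ 3 * (β - τ)) ∨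
      (β < τ ∧ τ < 1 ∧ r τ = ω ^ 2 * (1 - τ)) ∨
      r τ = 0 ∧ (τ ∈ Set.Icc (0 : ℝ) 1 → τ ∈ ({0, β ^ 2, β, 1} : Set ℝ)) := by
  unfold r
  split_ifs with h1 h2 h3
  · exact Or.inl ⟨h1.1, h1.2, rfl⟩
  · exact Or.inr (Or.inl ⟨h2.1, h2.2, rfl⟩)
  · exact Or.inr (Or.inr (Or.inl ⟨h3.1, h3.2, rfl⟩))
  · refine Or.inr (Or.inr (Or.inr ⟨rfl, fun h => ?_⟩))
    by_contra hn
    simp only [Set.mem_insert_iff, Set.mem_singleton_iff, not_or] at hn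
    have h0 : 0 < τ := lt_of_le_of_ne h.1 (Ne.symm hn.1)
    have h4 : β ^ 2 < τ :=
      lt_of_le_of_ne (not_lt.1 fun h' => h1 ⟨h0, h'⟩) (Ne.symm hn.2.1)
    have h5 : β < τ := lt_of_le_of_ne (not_lt.1 fun h' => h2 ⟨h4, h'⟩) (Ne.symm hn.2.2.1)
    exact h3 ⟨h5, lt_of_le_of_ne h.2 hn.2.2.2⟩

theorem r_mem_Icc (τ : ℝ) : r τ ∈ Set.Icc (0 : ℝ) 1 := by
  rcases r_cases τ with ⟨h0, h1, -⟩ | ⟨h0, h1, -⟩ | ⟨h0, h1, -⟩ | ⟨h, -⟩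
  · exact Set.Ioo_subset_Icc_self (r_mem_Ioo_of_lt_β_sq h0 h1)
  · exact Set.Ioo_subset_Icc_self (r_mem_Ioo_of_lt_β h0 h1)
  · exact Set.Ioo_subset_Icc_self (r_mem_Ioo_of_lt_one h0 h1)
  · rw [h]; exact ⟨le_rfl, zero_le_one⟩

/-- The three affine branches have inverses over the field, and where `r` is constant on the unit
interval, `τ` is one of four points of the field. -/
theorem mem_of_r_mem {τ : ℝ} (hτ : τ ∈ Set.Icc (0 : ℝ) 1) (h : r τ ∈ fieldQSqrtFive) :
    τ ∈ fieldQSqrtFive := by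
  have hω := ω_mem
  have hβ := β_mem
  rcases r_cases τ with ⟨-, -, e⟩ | ⟨-, -, e⟩ | ⟨-, -, e⟩ | ⟨-, h'⟩
  · have : τ = β ^ 2 * r τ := by rw [e]; linear_combination (-τ) * β_sq_mul_ω_sq
    rw [this]; exact mul_mem (pow_mem hβ 2) h
  · have : τ = β - β ^ 3 * r τ := by
      rw [e]; linear_combination (β - τ) * β_cube_mul_ω_cube
    rw [this]; exact sub_mem hβ (mul_mem (pow_mem hβ 3) h)
  · have : τ = 1 - β ^ 2 * r τ := by rw [e]; linear_combination (1 - τ) * β_sq_mul_ω_sq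
    rw [this]; exact sub_mem (one_mem _) (mul_mem (pow_mem hβ 2) h)
  · rcases h' hτ with rfl | rfl | rfl | rfl
    exacts [zero_mem _, pow_mem hβ 2, hβ, one_mem _]

theorem mem_of_iterate_r_mem {m : ℕ} : ∀ {τ : ℝ}, τ ∈ Set.Icc (0 : ℝ) 1 →
    r^[m] τ ∈ fieldQSqrtFive → τ ∈ fieldQSqrtFive := by
  induction m with
  | zero => exact fun _ h => h
  | succ m ih => exact fun hτ h => mem_of_r_mem hτ (ih (r_mem_Icc _) h)

/-- The renormalization function is piecewise affine and expanding or constant. -/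
theorem exists_r_eq (τ : ℝ) : ∃ a ∈ fieldQSqrtFive, ∃ b ∈ fieldQSqrtFive,
    r τ = a * τ + b ∧ (a = 0 ∨ 1 < |a|) := by
  have hω := ω_mem
  have hβ := β_mem
  have h1 : ∀ n : ℕ, n ≠ 0 → 1 < |ω ^ n| := fun n hn => by
    rw [abs_of_pos (pow_pos ω_pos n)]; exact one_lt_pow₀ one_lt_ω hn
  rcases r_cases τ with ⟨-, -, e⟩ | ⟨-, -, e⟩ | ⟨-, -, e⟩ | ⟨e, -⟩
  · exact ⟨ω ^ 2, pow_mem hω 2, 0, zero_mem _, by rw [e]; ring, Or.inr (h1 2 two_ne_zero)⟩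
  · exact ⟨-ω ^ 3, neg_mem (pow_mem hω 3), ω ^ 3 * β, mul_mem (pow_mem hω 3) hβ, by rw [e]; ring,
      Or.inr (by rw [abs_neg]; exact h1 3 three_ne_zero)⟩
  · exact ⟨-ω ^ 2, neg_mem (pow_mem hω 2), ω ^ 2, pow_mem hω 2, by rw [e]; ring,
      Or.inr (by rw [abs_neg]; exact h1 2 two_ne_zero)⟩
  · exact ⟨0, zero_mem _, 0, zero_mem _, by rw [e]; ring, Or.inl rfl⟩

theorem exists_iterate_r_eq (τ : ℝ) (n : ℕ) : ∃ a ∈ fieldQSqrtFive, ∃ b ∈ fieldQSqrtFive,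
    r^[n + 1] τ = a * τ + b ∧ (a = 0 ∨ 1 < |a|) := by
  induction n with
  | zero => exact exists_r_eq τ
  | succ n ih =>
    obtain ⟨a, ha, b, hb, e, h⟩ := ih
    obtain ⟨a', ha', b', hb', e', h'⟩ := exists_r_eq (r^[n + 1] τ)
    refine ⟨a' * a, mul_mem ha' ha, a' * b + b', add_mem (mul_mem ha' hb) hb', ?_, ?_⟩
    · rw [Function.iterate_succ_apply', e', e]; ring
    · rcases h with rfl | h
      · simp
      rcases h' with rfl | h'
      · simp
      exact Or.inr (by rw [abs_mul]; exact one_lt_mul_of_lt_of_le h' h.le)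

/-- The periodic value `σ` satisfies `σ = a σ + b` over the field with `a ≠ 1`, so it lies in the
field, and membership is pulled back along the preperiod. -/
theorem mem_of_selfSimilar {τ : ℝ} (hτ : τ ∈ Set.Icc (0 : ℝ) 1) (h : SelfSimilar τ) :
    τ ∈ QSqrtFive := by
  obtain ⟨m, n, hmn, h⟩ := h
  obtain ⟨k, rfl⟩ := Nat.exists_eq_add_of_lt hmn
  refine mem_of_iterate_r_mem (m := m) hτ ?_
  rw [show m + k + 1 = (k + 1) + m by ring, Function.iterate_add_apply] at h
  obtain ⟨a, ha, b, hb, e, ha1⟩ := exists_iterate_r_eq (r^[m] τ) k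
  generalize r^[m] τ = σ at *
  have h1 : 1 - a ≠ 0 := by
    intro h0
    have : a = 1 := by linarith
    subst this
    simp at ha1
  have : σ = b / (1 - a) := by
    rw [eq_div_iff h1]; linarith
  rw [this]
  exact div_mem hb (sub_mem (one_mem _) ha)

/-! ### Orbits in `ℚ(√5)`: fixed denominators and bounded conjugates -/

/-- The algebraic conjugate. -/
def GoldenInt.conj (g : GoldenInt) : GoldenInt := ⟨g.a + g.b, -g.b⟩

theorem GoldenInt.conj_add (g h : GoldenInt) : (g + h).conj = g.conj + h.conj := by
  ext
  · change g.a + h.a + (g.b + h.b) = g.a + g.b + (h.a + h.b); ring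
  · change -(g.b + h.b) = -g.b + -h.b; ring

theorem GoldenInt.conj_neg (g : GoldenInt) : (-g).conj = -g.conj := by
  ext
  · change -g.a + -g.b = -(g.a + g.b); ring
  · rfl

theorem GoldenInt.conj_mul (g h : GoldenInt) : (g * h).conj = g.conj * h.conj := by
  ext
  · change g.a * h.a + g.b * h.b + (g.a * h.b + g.b * h.a + g.b * h.b) =
      (g.a + g.b) * (h.a + h.b) + -g.b * -h.b
    ring
  · change -(g.a * h.b + g.b * h.a + g.b * h.b) =
      (g.a + g.b) * -h.b + -g.b * (h.a + h.b) + -g.b * -h.b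
    ring

theorem GoldenInt.finite_setOf_abs_le (C : ℝ) :
    {g : GoldenInt | |g.val| ≤ C ∧ |g.conj.val| ≤ C}.Finite := by
  -- The value minus its conjugate is `b * (2 ω - 1)` with `2 ω - 1 > 1`, so `|b| ≤ 2 C`; then `|a|
  -- ≤ C + 2 C ω ≤ 5 C`.
  obtain ⟨B, hB⟩ := exists_nat_ge (5 * C)
  have hinj : Function.Injective fun g : GoldenInt => (g.a, g.b) := fun g h e => by
    rw [Prod.mk.injEq] at e; exact GoldenInt.ext e.1 e.2
  refine Set.Finite.subset (Set.Finite.preimage hinj.injOn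
    ((Set.finite_Icc (-B : ℤ) B).prod (Set.finite_Icc (-B : ℤ) B))) ?_
  rintro ⟨a, b⟩ ⟨h1, h2⟩
  simp only [val, conj] at h1 h2
  push_cast at h1 h2
  rw [abs_le] at h1 h2
  have hω := one_lt_ω
  have hω2 := ω_lt_two
  have hC : 0 ≤ C := by linarith
  have hb1 : (b : ℝ) ≤ 2 * C := by
    by_contra h; nlinarith
  have hb2 : -(2 * C) ≤ (b : ℝ) := by
    by_contra h; nlinarith
  have hb3 : (b : ℝ) * ω ≤ 2 * C * ω := mul_le_mul_of_nonneg_right hb1 ω_pos.le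
  have hb4 : -(2 * C) * ω ≤ (b : ℝ) * ω := mul_le_mul_of_nonneg_right hb2 ω_pos.le
  have hC2 : C * ω ≤ C * 2 := mul_le_mul_of_nonneg_left hω2.le hC
  simp only [Set.mem_preimage, Set.mem_prod, Set.mem_Icc]
  refine ⟨⟨?_, ?_⟩, ?_, ?_⟩ <;> (rify; linarith)

/-- The numbers of the unit interval with a given denominator and bounded conjugate. -/
def boundedHeight (N : ℕ) (M : ℝ) : Set ℝ :=
  {x | x ∈ Set.Icc (0 : ℝ) 1 ∧ ∃ g : GoldenInt, N * x = g.val ∧ |g.conj.val| ≤ M * N}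

theorem finite_boundedHeight {N : ℕ} (hN : 0 < N) {M : ℝ} (hM : 1 ≤ M) :
    (boundedHeight N M).Finite := by
  have hN' : (0 : ℝ) < N := by exact_mod_cast hN
  refine ((GoldenInt.finite_setOf_abs_le (M * N)).image fun g => g.val / (N : ℝ)).subset ?_
  rintro x ⟨hx, g, hg, hM'⟩
  refine ⟨g, ⟨?_, hM'⟩, by simp only [← hg]; field_simp⟩
  rw [← hg, abs_of_nonneg (mul_nonneg hN'.le hx.1)]
  nlinarith [hx.2]

/-- Powers of `ω` are integral, so the denominator persists. Conjugation turns `ω ^ 2`, `ω ^ 3` into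
`β ^ 2`, `-β ^ 3`, and `M ≥ 1` absorbs the constant terms: the conjugate is multiplied by at most `β
^ 2`, `β ^ 2 + β ^ 3 = β` or `2 β ^ 2` relative to the bound `M N`, all below one. -/
theorem r_mem_boundedHeight {N : ℕ} {M : ℝ} (hM : 1 ≤ M) {x : ℝ} (hx : x ∈ boundedHeight N M) :
    r x ∈ boundedHeight N M := by
  refine ⟨r_mem_Icc x, ?_⟩
  obtain ⟨-, g, hg, hM'⟩ := hx
  have hN : (0 : ℝ) ≤ N := N.cast_nonneg
  have hβ := β_pos
  have hω2 : (ωPow 2).conj = βPow 2 := by decide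
  have hω3 : (ωPow 3).conj = -βPow 3 := by decide
  have hβ1 : (βPow 1).conj = -ωPow 1 := by decide
  have hNc : (ofNat N).conj.val = N := by simp [ofNat, conj, val]
  have h2 : 0 < β ^ 2 := β_sq_pos
  have h3 : β ^ 2 < 1 := β_sq_lt_β.trans β_lt_one
  have hMN : (N : ℝ) ≤ M * N := le_mul_of_one_le_left hN hM
  have hMN0 : 0 ≤ M * N := hN.trans hMN
  rw [abs_le] at hM'
  rcases r_cases x with ⟨-, -, e⟩ | ⟨-, -, e⟩ | ⟨-, -, e⟩ | ⟨e, -⟩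
  · refine ⟨ωPow 2 * g, by rw [e, val_mul, val_ωPow, ← hg]; ring, ?_⟩
    rw [conj_mul, hω2, val_mul, val_βPow, abs_le]
    constructor <;> nlinarith
  · refine ⟨ωPow 3 * (ofNat N * βPow 1 + -g), ?_, ?_⟩
    · rw [e, val_mul, val_add, val_mul, val_neg, val_ωPow, val_βPow, val_ofNat, ← hg]; ring
    · rw [conj_mul, conj_add, conj_mul, conj_neg, hω3, hβ1]
      simp only [val_mul, val_add, val_neg, val_ωPow, val_βPow, hNc]
      generalize g.conj.val = v at *
      have e1 : -β ^ 3 * (N * -ω ^ 1 + -v) = β ^ 2 * N + β ^ 3 * v := by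
        linear_combination β ^ 2 * N * β_mul_ω
      have e2 : β ^ 3 = β - β ^ 2 := by
        have : β ^ 2 = 1 - β := by rw [β_sq, β_eq]; ring
        linear_combination (β + 1) * this - this
      have h4 : 0 < β ^ 3 := pow_pos hβ 3
      rw [e1, abs_le]
      have h5 : β ^ 3 * v ≤ β ^ 3 * (M * N) := mul_le_mul_of_nonneg_left hM'.2 h4.le
      have h6 : β ^ 3 * (-(M * N)) ≤ β ^ 3 * v := mul_le_mul_of_nonneg_left hM'.1 h4.le
      have h7 : β ^ 2 * N ≤ β ^ 2 * (M * N) := mul_le_mul_of_nonneg_left hMN h2.le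
      have h8 : 0 ≤ β ^ 2 * N := mul_nonneg h2.le hN
      have h9 : (β ^ 2 + β ^ 3) * (M * N) ≤ 1 * (M * N) :=
        mul_le_mul_of_nonneg_right (by rw [e2]; linarith [β_lt_one]) hMN0
      have h10 : β ^ 3 * (M * N) ≤ 1 * (M * N) :=
        mul_le_mul_of_nonneg_right (by rw [e2]; linarith [β_lt_one]) hMN0
      constructor <;> linarith
  · refine ⟨ωPow 2 * (ofNat N + -g), ?_, ?_⟩
    · rw [e, val_mul, val_add, val_neg, val_ωPow, val_ofNat, ← hg]; ring
    · rw [conj_mul, conj_add, conj_neg, hω2]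
      simp only [val_mul, val_add, val_neg, val_βPow, hNc]
      generalize g.conj.val = v at *
      have e1 : 2 * β ^ 2 ≤ 1 := by rw [β_sq]; linarith [three_halves_lt_ω]
      rw [abs_le]
      constructor <;> nlinarith
  · exact ⟨0, by simp [e], by rw [show conj 0 = 0 from rfl, val_zero, abs_zero]; exact hMN0⟩

theorem exists_mem_boundedHeight {x : ℝ} (hx : x ∈ Set.Icc (0 : ℝ) 1) (h : x ∈ QSqrtFive) :
    ∃ N : ℕ, 0 < N ∧ ∃ M : ℝ, 1 ≤ M ∧ x ∈ boundedHeight N M := by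
  obtain ⟨a, b, rfl⟩ := h
  have hN : 0 < a.den * b.den := Nat.mul_pos a.den_pos b.den_pos
  have hN' : (1 : ℝ) ≤ (a.den * b.den : ℕ) := by exact_mod_cast hN
  -- The numerator over the common denominator, rewritten with `√5 = 2 ω - 1`.
  let g : GoldenInt := ⟨a.num * b.den - b.num * a.den, 2 * (b.num * a.den)⟩
  refine ⟨a.den * b.den, hN, max 1 |g.conj.val|, le_max_left _ _, hx, g, ?_, ?_⟩
  · have ha : (a : ℝ) * a.den = a.num := by exact_mod_cast Rat.mul_den_eq_num a
    have hb : (b : ℝ) * b.den = b.num := by exact_mod_cast Rat.mul_den_eq_num b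
    simp only [g, val]
    push_cast
    rw [← ha, ← hb, ω]
    ring
  · exact (le_max_right 1 _).trans (le_mul_of_one_le_right (by positivity) hN')

/-- Pigeonhole: the infinite sequence of iterates stays in a finite set. -/
theorem selfSimilar_of_mem {τ : ℝ} (hτ : τ ∈ Set.Icc (0 : ℝ) 1) (h : τ ∈ QSqrtFive) :
    SelfSimilar τ := by
  obtain ⟨N, hN, M, hM, hmem⟩ := exists_mem_boundedHeight hτ h
  have horb : ∀ n, r^[n] τ ∈ boundedHeight N M := by
    intro n
    induction n with
    | zero => exact hmem
    | succ n ih => rw [Function.iterate_succ_apply']; exact r_mem_boundedHeight hM ih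
  have := (finite_boundedHeight hN hM).to_subtype
  obtain ⟨m, n, hmn, e⟩ :=
    Finite.exists_ne_map_eq_of_infinite fun n => (⟨_, horb n⟩ : boundedHeight N M)
  have e := congrArg Subtype.val e
  rcases lt_or_gt_of_ne hmn with h | h
  exacts [⟨m, n, h, e⟩, ⟨n, m, h, e.symm⟩]

end PWI

theorem lemma1 :
    -- the three parameter ranges, for `𝓑` (`t = false`) and for `𝓑̃` (`t = true`)
    (∀ (t : Bool) (τ : ℝ),
      (0 < τ → τ < PWI.β ^ 2 →
        PWI.r τ = PWI.ω ^ 2 * τ ∧ PWI.r τ ∈ Set.Ioo (0 : ℝ) 1 ∧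
        PWI.Renormalizes (PWI.base t τ) (PWI.base t (PWI.r τ))
          (PWI.tile (PWI.signed t (PWI.sidesSub τ))) ((1 - τ) / (PWI.ω ^ 2 - τ))) ∧
      (PWI.β ^ 2 < τ → τ < PWI.β →
        PWI.r τ = PWI.ω ^ 3 * (PWI.β - τ) ∧ PWI.r τ ∈ Set.Ioo (0 : ℝ) 1 ∧
        PWI.Renormalizes (PWI.base t τ) (PWI.base (!t) (PWI.r τ))
          (PWI.atom t τ 2) (τ / (PWI.ω ^ 2 - τ))) ∧
      (PWI.β < τ → τ < 1 →
        PWI.r τ = PWI.ω ^ 2 * (1 - τ) ∧ PWI.r τ ∈ Set.Ioo (0 : ℝ) 1 ∧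
        PWI.Renormalizes (PWI.base t τ) (PWI.base (!t) (PWI.r τ))
          (PWI.atom t τ 2) (τ / (PWI.ω ^ 2 - τ)))) ∧
    -- the endpoints of the three ranges
    (∀ (t : Bool) (τ : ℝ), τ ∈ ({0, PWI.β ^ 2, PWI.β, 1} : Set ℝ) →
      PWI.r τ = 0 ∧
      ∃ t' : Bool, PWI.RenormalizesLimit (PWI.baseExt t τ) (PWI.baseExt t' (PWI.r τ))) ∧
    -- self-similarity
    (∀ τ ∈ Set.Icc (0 : ℝ) 1, PWI.SelfSimilar τ ↔ τ ∈ PWI.QSqrtFive) := by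
  refine ⟨fun t τ => ⟨fun h0 h1 => ?_, fun h0 h1 => ?_, fun h0 h1 => ?_⟩, fun t τ hτ => ?_,
    fun τ hτ => ⟨PWI.mem_of_selfSimilar hτ, PWI.selfSimilar_of_mem hτ⟩⟩
  · exact ⟨PWI.r_of_lt_β_sq h0 h1, PWI.r_mem_Ioo_of_lt_β_sq h0 h1,
      PWI.renormalizes_of_lt_β_sq t h0 h1⟩
  · exact ⟨PWI.r_of_lt_β h0 h1, PWI.r_mem_Ioo_of_lt_β h0 h1, PWI.renormalizes_of_lt_β t h0 h1⟩
  · exact ⟨PWI.r_of_lt_one h0 h1, PWI.r_mem_Ioo_of_lt_one h0 h1,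
      PWI.renormalizes_of_lt_one t h0 h1⟩
  · have hr := PWI.r_eq_zero hτ
    rw [hr]
    refine ⟨rfl, ?_⟩
    rcases hτ with rfl | rfl | rfl | rfl
    exacts [⟨t, PWI.renormalizesLimit_zero t⟩, ⟨!t, PWI.renormalizesLimit_β_sq t⟩,
      ⟨!t, PWI.renormalizesLimit_β t⟩, ⟨!t, PWI.renormalizesLimit_one t⟩]
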